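/- Let $n\ge 1$. A two-cube is a set $A=A_1\times\cdots\times A_n\subset\mathbb Z^n$ in which each $A_j=\{u_j,v_j\}$ consists of two distinct integers; its differences are $d_j=u_j-v_j$. For an integer $\ell>0$ let $r_\ell(A)$ be the number of $(\epsilon,j)\in\{\pm1\}^{2\ell}\times[n]^{2\ell}$ with $\epsilon_1d_{j_1}+\cdots+\epsilon_{2\ell}d_{j_{2\ell}}=0$. For $C>0$ put $$R_{C,\ell}(A)=\frac{C^\ell r_\ell(A)}{n^{2\ell+1/2}}+\exp\left(-\tfrac nC\right),\qquad R_C(A)=\inf\{R_{C,\ell}(A):\ell\ge 1\},$$ $$\mu_C(A)=\inf\Big\{\mu\in[0,1]:\ \exists\,\nu\in(0,1]\quad \mu^{(1+\nu)^2}\ \ge\ 3\exp\left(-\tfrac{\nu n}{C}\right)+\frac{R_C(A)}{50\sqrt\nu}\Big\},$$ where the infimum of the empty set is taken to be $1$. Theorem. For every $\beta>0$ and $\delta>0$ there is $C>0$ such that the following holds for every $n\ge1$. Let $B\subseteq\{\pm1\}^n$ be of size $2^{\beta n}$, let $Y$ be uniformly distributed in $B$, let $\theta$ be uniformly distributed in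 $[0,1]$, and let $A\subset\mathbb Z^n$ be a two-cube. Then all but at most $2^{n(1-\beta+\delta)}$ directions $x\in A$ satisfy $$\mathbb E_\theta\Big|\mathbb E_Y\exp\big(2\pi i\theta\langle x,Y\rangle\big)\Big|\le\mu_C(A).$$ -/

import Mathlib

open Finset

/-- The hypercube `{±1}ⁿ`, as a finite set of integer vectors. -/
def signCube (n : ℕ) : Finset (Fin n → ℤ) :=
  Fintype.piFinset fun _ => {1, -1}

/-- A two-cube `A₁ × ⋯ × Aₙ ⊂ ℤⁿ`, where each `Aⱼ = {uⱼ, vⱼ}` consists of two distinct integers. -/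
structure TwoCube (n : ℕ) where
  /-- the elements `uⱼ` -/
  u : Fin n → ℤ
  /-- the elements `vⱼ` -/
  v : Fin n → ℤ
  ne : ∀ j, u j ≠ v j

namespace TwoCube

variable {n : ℕ}

/-- The set of points (directions) of the two-cube. -/
def points (A : TwoCube n) : Finset (Fin n → ℤ) :=
  Fintype.piFinset fun j => {A.u j, A.v j}

/-- The differences `dⱼ = uⱼ - vⱼ`. -/
def diff (A : TwoCube n) (j : Fin n) : ℤ := A.u j - A.v j

/-- `r_ℓ(A)`: the number of `(ε, j) ∈ {±1}^{2ℓ} × [n]^{2ℓ}` such that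
`ε₁ d_{j₁} + ⋯ + ε_{2ℓ} d_{j_{2ℓ}} = 0`. -/
def r (A : TwoCube n) (ℓ : ℕ) : ℕ :=
  #{p ∈ signCube (2 * ℓ) ×ˢ (univ : Finset (Fin (2 * ℓ) → Fin n)) |
    ∑ k, p.1 k * A.diff (p.2 k) = 0}

/-- `R_{C,ℓ}(A) = C^ℓ r_ℓ(A) / n^{2ℓ + 1/2} + exp(-n/C)`. -/
noncomputable def RAt (C : ℝ) (A : TwoCube n) (ℓ : ℕ) : ℝ :=
  C ^ ℓ * (A.r ℓ : ℝ) / (n : ℝ) ^ (2 * (ℓ : ℝ) + 1 / 2) + Real.exp (-((n : ℝ) / C))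

/-- `R_C(A)`: the infimum of `R_{C,ℓ}(A)` over the integers `ℓ > 0`. -/
noncomputable def R (C : ℝ) (A : TwoCube n) : ℝ :=
  sInf {t : ℝ | ∃ ℓ : ℕ, 0 < ℓ ∧ t = RAt C A ℓ}

/-- The set of `μ ∈ [0,1]` for which there is `ν ∈ (0,1]` with
`μ^{(1+ν)²} ≥ 3 exp(-νn/C) + R_C(A) / (50 √ν)`. -/
def admissible (C : ℝ) (A : TwoCube n) : Set ℝ :=
  {μ : ℝ | μ ∈ Set.Icc (0 : ℝ) 1 ∧ ∃ ν ∈ Set.Ioc (0 : ℝ) 1,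
    3 * Real.exp (-(ν * (n : ℝ) / C)) + R C A / (50 * Real.sqrt ν) ≤ μ ^ ((1 + ν) ^ 2)}

open Classical in
/-- `μ_C(A)`: the infimum of the admissible `μ`; the infimum of the empty set is `1`. -/
noncomputable def mu (C : ℝ) (A : TwoCube n) : ℝ :=
  if (admissible C A).Nonempty then sInf (admissible C A) else 1

end TwoCube

/-- `E_Y exp(2πiθ⟨x, Y⟩)` for `Y` uniformly distributed in the finite set `B`. -/
noncomputable def charAvg {n : ℕ} (B : Finset (Fin n → ℤ)) (x : Fin n → ℤ) (θ : ℝ) : ℂ :=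
  (∑ y ∈ B, Complex.exp (2 * (Real.pi : ℂ) * Complex.I * (θ : ℂ) * ((∑ j, x j * y j : ℤ) : ℂ))) /
    (#B : ℂ)

/-- `E_θ |E_Y exp(2πiθ⟨x, Y⟩)|` for `θ` uniform in `[0,1]` and `Y` uniform in `B`. -/
noncomputable def fourierAvg {n : ℕ} (B : Finset (Fin n → ℤ)) (x : Fin n → ℤ) : ℝ :=
  ∫ θ in (0 : ℝ)..1, ‖charAvg B x θ‖

/-!
Suppose the set `S` of bad directions has more than `2 ^ (n (1 - β + δ))` elements. Let `X` and
`Y` be uniform in `S` and `B` and write `F(X)` for the Fourier average, so that `F > μ` on `S` for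
some admissible `μ`, with a witness `ν`. The contradiction comes from the bound
`(E F(X)) ^ ((1 + ν)²) ≤ 3 exp (-ν n / C) + R_C(A) / (50 √ν)`.

*One frequency.* Fix `θ`. Both `S` and `B` are coded by Boolean cubes. The coordinates are peeled
off one at a time, the coordinate being peeled off having its law conditioned on the *earlier*
coordinates of `Y` and on the *later* coordinates of `X`. If both conditional laws are
`κ`-balanced, the step gains a factor `exp (-c ν sin² (2πθ dⱼ))`: averages of `exp (±iα) z` over
`Y_j` are shorter than the `L^{1+ν}`-norm of `z` for at least one of the two values of `X_j`, by
strict convexity or because the phases `2α` for these two values differ (`exists_phase_gain`), and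
Hölder's inequality turns this into a gain on average (`sum_mul_le_holder_gain`). The gains
already collected depend on `X`; they are carried as a weight `W` and only its `L^{1+ν}`-mean is
kept, which costs the second exponent `1 + ν`. The outcome (`sum_signSum_rpow_le`,
`mean_signSum_rpow_le`) is
`E_X |E_Y e(θ⟨X,Y⟩)| ^ (1+ν) ≤ (E exp (-c ν ∑ sin² (2πθ dⱼ))) ^ (1/(1+ν))`, the sum being over the coordinates that branch for both `X` and `Y`.
Given `X` and `Y`, this set of coordinates does not depend on `θ`.

*Many branching coordinates.* A set of `2 ^ (σ n)` points has, for most of its points, at least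
about `σ n` branching coordinates (`sum_sqrt_lateBranch_le`, `sum_sqrt_earlyBranch_le`,
`card_few_le`). Since `|S| |B| ≥ 2 ^ (n (1 + δ))`, at least `δ n / 2` coordinates branch for both
`X` and `Y`, outside an event of exponentially small probability (`sum_pairs_le`).

*Average over the frequency.* For a fixed set `J` of at least `δ n / 2` coordinates, Halász's
method bounds `E_θ exp (-b ∑_J sin²)`: the set where the sum over `J` is at most `τ²` grows
linearly in `τ` by the Cauchy–Davenport inequality, and its size at scale `τ² = |J| / 8` is
controlled by the `2ℓ`-th moment of `∑_J cos (4πθ dⱼ)`, that is by `r_ℓ(A)`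
(`average_exp_sineEnergy_le`). To have Cauchy–Davenport at hand, `θ` is restricted to the
multiples of `1 / N` with `N` prime; letting `N → ∞` recovers the integral (`tendsto_riemann_sum`,
`mean_fourierAvg_rpow_le`).
-/

/-! ### One coordinate -/

lemma mean_rpow_gain {q₁ q₂ a b κ ν : ℝ} (hκ : 0 < κ) (h₁ : κ ≤ q₁) (h₂ : κ ≤ q₂)
    (hq : q₁ + q₂ = 1) (hb : 0 ≤ b) (hab : 4 * b ≤ a) (hν : 0 < ν) :
    (q₁ * a + q₂ * b) ^ (1 + ν) ≤
      Real.exp (-(ν * κ / 8)) * (q₁ * a ^ (1 + ν) + q₂ * b ^ (1 + ν)) := by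
  have ha : 0 ≤ a := by linarith
  rcases ha.eq_or_lt with rfl | ha'
  · have hb0 : b = 0 := by linarith
    subst hb0
    simp [Real.zero_rpow (by linarith : 1 + ν ≠ 0)]
  set A := Real.sqrt a with hA
  set B := Real.sqrt b with hB
  have hA2 : a = A ^ 2 := (Real.sq_sqrt ha).symm
  have hB2 : b = B ^ 2 := (Real.sq_sqrt hb).symm
  have hA0 : 0 < A := Real.sqrt_pos.2 ha'
  have hB0 : 0 ≤ B := Real.sqrt_nonneg _
  have hq1 : 0 < q₁ := by linarith
  have hq2 : 0 < q₂ := by linarith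
  have hAB : 2 * B ≤ A := by
    apply le_of_sq_le_sq _ hA0.le
    nlinarith
  set E := q₁ * A + q₂ * B with hE
  have hE0 : 0 < E := by positivity
  set m := q₁ * a + q₂ * b with hm
  have hm0 : 0 < m := by positivity
  -- Jensen's inequality for the law `q` tilted by the square root of the values: it gives
  -- `m ^ (1 + ν) * (m / E ^ 2) ^ ν` as a lower bound, where `m / E ^ 2` exceeds `1`.
  have key := (convexOn_rpow (p := 1 + 2 * ν) (by linarith)).2 (Set.mem_Ici.2 hA0.le)
    (Set.mem_Ici.2 hB0) (show 0 ≤ q₁ * A / E by positivity) (show 0 ≤ q₂ * B / E by positivity)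
    (by rw [← add_div]; exact div_self hE0.ne')
  simp only [smul_eq_mul] at key
  have hpow : ∀ x : ℝ, 0 ≤ x → x * x ^ (1 + 2 * ν) = (x ^ 2) ^ (1 + ν) := by
    intro x hx
    rcases hx.eq_or_lt with rfl | hx
    · simp [Real.zero_rpow (by linarith : 1 + ν ≠ 0)]
    · rw [← Real.rpow_natCast, ← Real.rpow_mul hx.le]
      nth_rewrite 1 [← Real.rpow_one x]
      rw [← Real.rpow_add hx]
      congr 1; push_cast; ring
  have hl : q₁ * A / E * A + q₂ * B / E * B = m / E := by
    rw [hm, hA2, hB2]; field_simp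
  have hr : q₁ * A / E * A ^ (1 + 2 * ν) + q₂ * B / E * B ^ (1 + 2 * ν) =
      (q₁ * a ^ (1 + ν) + q₂ * b ^ (1 + ν)) / E := by
    rw [hA2, hB2, ← hpow A hA0.le, ← hpow B hB0]; ring
  rw [hl, hr, le_div_iff₀ hE0] at key
  have hgap : E ^ 2 ≤ m * (1 - κ / 8) := by
    have h1 : m - E ^ 2 = q₁ * q₂ * (A - B) ^ 2 := by
      rw [hm, hE, hA2, hB2]
      have : q₂ = 1 - q₁ := by linarith
      rw [this]; ring
    have h2 : κ / 2 ≤ q₁ * q₂ := by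
      rcases le_total q₁ q₂ with h | h <;> nlinarith
    have h3 : A ^ 2 / 4 ≤ (A - B) ^ 2 := by nlinarith
    have h4 : m ≤ A ^ 2 := by rw [hm, hA2, hB2]; nlinarith
    have h5 : κ / 2 * (A ^ 2 / 4) ≤ q₁ * q₂ * (A - B) ^ 2 :=
      mul_le_mul h2 h3 (by positivity) (by positivity)
    nlinarith
  have hgap' : Real.exp (κ / 8) ≤ m / E ^ 2 := by
    rw [le_div_iff₀ (by positivity)]
    have h1 : E ^ 2 ≤ m * Real.exp (-(κ / 8)) :=
      hgap.trans (mul_le_mul_of_nonneg_left (by have := Real.add_one_le_exp (-(κ / 8)); linarith)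
        hm0.le)
    calc Real.exp (κ / 8) * E ^ 2 ≤ Real.exp (κ / 8) * (m * Real.exp (-(κ / 8))) := by gcongr
      _ = m := by rw [mul_comm m, ← mul_assoc, ← Real.exp_add]; simp
  have hrew : (m / E) ^ (1 + 2 * ν) * E = m ^ (1 + ν) * (m / E ^ 2) ^ ν := by
    have hu : 0 < m / E := by positivity
    rw [Real.rpow_add hu, Real.rpow_one, Real.rpow_mul hu.le, Real.rpow_add hm0, Real.rpow_one]
    have : (m / E) ^ (2 : ℝ) = m * (m / E ^ 2) := by
      rw [Real.rpow_two]; field_simp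
    rw [this, Real.mul_rpow hm0.le (by positivity)]
    field_simp
  rw [hrew] at key
  have hexp : Real.exp (ν * κ / 8) ≤ (m / E ^ 2) ^ ν := by
    calc Real.exp (ν * κ / 8) = Real.exp (κ / 8) ^ ν := by
          rw [← Real.exp_mul]; congr 1; ring
      _ ≤ _ := Real.rpow_le_rpow (Real.exp_pos _).le hgap' hν.le
  have h6 : m ^ (1 + ν) * Real.exp (ν * κ / 8) ≤ q₁ * a ^ (1 + ν) + q₂ * b ^ (1 + ν) :=
    le_trans (mul_le_mul_of_nonneg_left hexp (by positivity)) key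
  calc m ^ (1 + ν) = Real.exp (-(ν * κ / 8)) * (m ^ (1 + ν) * Real.exp (ν * κ / 8)) := by
        rw [mul_comm (m ^ (1 + ν)), ← mul_assoc, ← Real.exp_add]; simp
    _ ≤ _ := by gcongr

lemma cos_le_or_cos_le (x d : ℝ) :
    Real.cos x ≤ 1 - Real.sin d ^ 2 / 2 ∨ Real.cos (x - 2 * d) ≤ 1 - Real.sin d ^ 2 / 2 := by
  by_contra! h
  have h1 : Real.cos x + Real.cos (x - 2 * d) = 2 * Real.cos (x - d) * Real.cos d := by
    have e1 : x = (x - d) + d := by ring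
    have e2 : x - 2 * d = (x - d) - d := by ring
    rw [e2]; nth_rewrite 1 [e1]
    rw [Real.cos_add, Real.cos_sub (x - d) d]; ring
  have h2 := Real.sin_sq_add_cos_sq d
  have h3 : Real.cos (x - d) * Real.cos d ≤ |Real.cos d| := by
    refine (le_abs_self _).trans ?_
    rw [abs_mul]
    exact mul_le_of_le_one_left (abs_nonneg _) (Real.abs_cos_le_one _)
  nlinarith [sq_abs (Real.cos d), sq_nonneg (|Real.cos d| - 1)]

lemma normSq_add_exp (A B x y : ℝ) :
    ‖(A : ℂ) * Complex.exp (x * Complex.I) + (B : ℂ) * Complex.exp (y * Complex.I)‖ ^ 2 =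
      (A + B) ^ 2 - 2 * (A * B) * (1 - Real.cos (x - y)) := by
  rw [← Complex.normSq_eq_norm_sq, Complex.normSq_apply]
  simp only [Complex.add_re, Complex.add_im, Complex.re_ofReal_mul, Complex.im_ofReal_mul,
    Complex.exp_ofReal_mul_I_re, Complex.exp_ofReal_mul_I_im]
  rw [Real.cos_sub]
  linear_combination A ^ 2 * Real.sin_sq_add_cos_sq x + B ^ 2 * Real.sin_sq_add_cos_sq y

/-- The sign `±1` encoded by a Boolean. -/
def boolSign (b : Bool) : ℝ := if b then 1 else -1

lemma norm_sum_le_mean {q : Bool → ℝ} (hq : ∀ b, 0 ≤ q b) (α : ℝ) (z : Bool → ℂ) :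
    ‖∑ b, (q b : ℂ) * Complex.exp ((α * boolSign b : ℝ) * Complex.I) * z b‖ ≤
      ∑ b, q b * ‖z b‖ := by
  refine (norm_sum_le _ _).trans (le_of_eq (Finset.sum_congr rfl fun b _ => ?_))
  rw [norm_mul, norm_mul, Complex.norm_exp_ofReal_mul_I, Complex.norm_real,
    Real.norm_of_nonneg (hq b), mul_one]

lemma mean_rpow_le {q : Bool → ℝ} (hq : ∀ b, 0 ≤ q b) (hq1 : ∑ b, q b = 1) {z : Bool → ℝ}
    (hz : ∀ b, 0 ≤ z b) {ν : ℝ} (hν : 0 < ν) :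
    (∑ b, q b * z b) ^ (1 + ν) ≤ ∑ b, q b * z b ^ (1 + ν) :=
  Real.rpow_arith_mean_le_arith_mean_rpow _ _ _ (fun b _ => hq b) hq1 (fun b _ => hz b)
    (by linarith)

/-- If a two-point law `q` is `κ`-balanced, then for one of the two directions `a` the average of
`exp(±i α a) z` over `q` is smaller than the `L^{1+ν}`-norm of `z` by a definite factor: either
`‖z‖` is far from constant and strict convexity gives the gain, or `‖z‖` is nearly constant and the
phases cannot cancel for both directions. -/
lemma exists_phase_gain {q : Bool → ℝ} {κ ν : ℝ} (hκ : 0 < κ) (hq : ∀ b, κ ≤ q b)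
    (hq1 : ∑ b, q b = 1) (hν : 0 < ν) (α : Bool → ℝ) (z : Bool → ℂ) :
    ∃ a, ‖∑ b, (q b : ℂ) * Complex.exp ((α a * boolSign b : ℝ) * Complex.I) * z b‖ ^ (1 + ν) ≤
      Real.exp (-(ν * κ * Real.sin (α true - α false) ^ 2 / 16)) *
        ∑ b, q b * ‖z b‖ ^ (1 + ν) := by
  have hq0 : ∀ b, 0 ≤ q b := fun b => hκ.le.trans (hq b)
  set s := Real.sin (α true - α false) ^ 2 with hs
  have hs0 : 0 ≤ s := sq_nonneg _
  have hs1 : s ≤ 1 := Real.sin_sq_le_one _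
  have hE0 : 0 ≤ ∑ b, q b * ‖z b‖ ^ (1 + ν) :=
    Finset.sum_nonneg fun b _ => mul_nonneg (hq0 b) (by positivity)
  have hle : Real.exp (-(ν * κ / 8)) ≤ Real.exp (-(ν * κ * s / 16)) := by
    apply Real.exp_le_exp.2
    have : 0 ≤ ν * κ := by positivity
    nlinarith
  have hq1' : q true + q false = 1 := by simpa using hq1
  have hq1'' : q false + q true = 1 := by linarith
  -- If one of the norms is at least four times the other, convexity gives the gain for both `a`.
  by_cases c1 : 4 * ‖z false‖ ≤ ‖z true‖
  · refine ⟨true, ?_⟩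
    have h := mean_rpow_gain hκ (hq true) (hq false) hq1' (norm_nonneg _) c1 hν
    refine (Real.rpow_le_rpow (norm_nonneg _) (norm_sum_le_mean hq0 _ z) (by linarith)).trans ?_
    rw [Fintype.sum_bool] at hE0 ⊢
    rw [Fintype.sum_bool]
    exact h.trans (by gcongr)
  by_cases c2 : 4 * ‖z true‖ ≤ ‖z false‖
  · refine ⟨true, ?_⟩
    have h := mean_rpow_gain hκ (hq false) (hq true) hq1'' (norm_nonneg _) c2 hν
    refine (Real.rpow_le_rpow (norm_nonneg _) (norm_sum_le_mean hq0 _ z) (by linarith)).trans ?_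
    rw [Fintype.sum_bool] at hE0 ⊢
    rw [Fintype.sum_bool]
    rw [add_comm (q true * _), add_comm (q true * _)]
    rw [add_comm (q true * _)] at hE0
    exact h.trans (by gcongr)
  push Not at c1 c2
  set a₁ := ‖z true‖ with ha₁
  set a₂ := ‖z false‖ with ha₂
  have ha1 : 0 ≤ a₁ := norm_nonneg _
  have ha2 : 0 ≤ a₂ := norm_nonneg _
  set m := q true * a₁ + q false * a₂ with hm
  have hm0 : 0 ≤ m := by have := hq0 true; have := hq0 false; positivity
  have hsq : ∀ a, ‖∑ b, (q b : ℂ) * Complex.exp ((α a * boolSign b : ℝ) * Complex.I) * z b‖ ^ 2 =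
      m ^ 2 - 2 * (q true * a₁ * (q false * a₂)) *
        (1 - Real.cos (2 * α a + ((z true).arg - (z false).arg))) := by
    intro a
    have h := normSq_add_exp (q true * a₁) (q false * a₂) (α a + (z true).arg)
      (-α a + (z false).arg)
    rw [show α a + (z true).arg - (-α a + (z false).arg) =
      2 * α a + ((z true).arg - (z false).arg) by ring] at h
    rw [hm, ← h, Fintype.sum_bool]
    congr 2
    nth_rewrite 1 [← Complex.norm_mul_exp_arg_mul_I (z true)]
    nth_rewrite 1 [← Complex.norm_mul_exp_arg_mul_I (z false)]
    rw [← ha₁, ← ha₂]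
    simp only [boolSign, if_true, Bool.false_eq_true, if_false]
    push_cast
    rw [add_mul, add_mul, Complex.exp_add, Complex.exp_add]
    ring_nf
  have hprod : κ / 8 * m ^ 2 ≤ q true * a₁ * (q false * a₂) := by
    have h2 : κ / 2 ≤ q true * q false := by
      have := hq true; have := hq false
      rcases le_total (q true) (q false) with h | h <;> nlinarith
    have h3 : m ^ 2 / 4 ≤ a₁ * a₂ := by
      rcases le_total a₁ a₂ with h | h
      · have : m ≤ a₂ := by have := hq0 true; rw [hm]; nlinarith
        nlinarith
      · have : m ≤ a₁ := by have := hq0 false; rw [hm]; nlinarith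
        nlinarith
    calc κ / 8 * m ^ 2 = κ / 2 * (m ^ 2 / 4) := by ring
      _ ≤ q true * q false * (a₁ * a₂) := mul_le_mul h2 h3 (by positivity) (by
          have := hq0 true; have := hq0 false; positivity)
      _ = _ := by ring
  have hfin : ∀ a, Real.cos (2 * α a + ((z true).arg - (z false).arg)) ≤ 1 - s / 2 →
      ‖∑ b, (q b : ℂ) * Complex.exp ((α a * boolSign b : ℝ) * Complex.I) * z b‖ ^ (1 + ν) ≤
      Real.exp (-(ν * κ * s / 16)) * ∑ b, q b * ‖z b‖ ^ (1 + ν) := by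
    intro a ha
    set h := ‖∑ b, (q b : ℂ) * Complex.exp ((α a * boolSign b : ℝ) * Complex.I) * z b‖ with hh
    have hh0 : 0 ≤ h := norm_nonneg _
    have hP0 : 0 ≤ κ / 8 * m ^ 2 := by positivity
    have h1 : h ^ 2 ≤ m ^ 2 * (1 - κ * s / 8) := by
      rw [hsq a]; nlinarith
    have h2 : h ^ 2 ≤ (m * Real.exp (-(κ * s / 16))) ^ 2 := by
      refine h1.trans ?_
      rw [mul_pow, ← Real.exp_nat_mul]
      refine mul_le_mul_of_nonneg_left ?_ (sq_nonneg _)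
      have := Real.add_one_le_exp (((2 : ℕ) : ℝ) * -(κ * s / 16))
      push_cast at this ⊢
      linarith
    have h3 : h ≤ m * Real.exp (-(κ * s / 16)) := le_of_sq_le_sq h2 (by positivity)
    have h4 : m ^ (1 + ν) ≤ ∑ b, q b * ‖z b‖ ^ (1 + ν) := by
      have := mean_rpow_le hq0 hq1 (fun b => norm_nonneg (z b)) hν
      rwa [Fintype.sum_bool] at this
    calc h ^ (1 + ν) ≤ (m * Real.exp (-(κ * s / 16))) ^ (1 + ν) :=
          Real.rpow_le_rpow hh0 h3 (by linarith)
      _ = Real.exp (-(κ * s / 16) * (1 + ν)) * m ^ (1 + ν) := by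
          rw [Real.mul_rpow hm0 (Real.exp_pos _).le, ← Real.exp_mul, mul_comm]
      _ ≤ _ := by
          gcongr
          have : 0 ≤ κ * s := by positivity
          nlinarith
  rcases cos_le_or_cos_le (2 * α true + ((z true).arg - (z false).arg)) (α true - α false)
    with h | h
  · exact ⟨true, hfin true h⟩
  · refine ⟨false, hfin false ?_⟩
    convert h using 2
    ring

lemma half_le_one_sub_exp {x : ℝ} (h0 : 0 ≤ x) (h1 : x ≤ 1) : x / 2 ≤ 1 - Real.exp (-x) := by
  have h := Real.add_one_le_exp x
  have h2 : Real.exp (-x) ≤ (1 + x)⁻¹ := by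
    rw [Real.exp_neg]; exact inv_anti₀ (by linarith) (by linarith)
  have h3 : (1 + x)⁻¹ ≤ 1 - x / 2 := by
    rw [inv_eq_one_div, div_le_iff₀ (by linarith)]; nlinarith
  linarith

/-- Hölder's inequality with a gain: a factor `t ≤ 1` that is at most `exp(-η)` on one point of mass
at least a `κ`-fraction improves the bound, and by `exp(-κη/2)` uniformly in `ν`, since the
conjugate exponent of `1 + ν` is large. -/
lemma sum_mul_le_holder_gain {P W t : Bool → ℝ} (hP : ∀ a, 0 ≤ P a) (hW : ∀ a, 0 ≤ W a)
    (ht : ∀ a, 0 ≤ t a) (ht1 : ∀ a, t a ≤ 1) {κ η ν : ℝ} (hν : 0 < ν) (hν1 : ν ≤ 1)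
    (hη : 0 ≤ η) (hην : η ≤ ν / 2) (a₀ : Bool) (hPa : κ * ∑ a, P a ≤ P a₀)
    (hta : t a₀ ≤ Real.exp (-η)) :
    ∑ a, P a * W a * t a ≤ Real.exp (-(κ * η / 2)) * (∑ a, P a) ^ (ν / (1 + ν)) *
      (∑ a, P a * W a ^ (1 + ν)) ^ (1 / (1 + ν)) := by
  have hν' : (0 : ℝ) < 1 + ν := by linarith
  set r := (1 + ν) / ν with hr
  have hr0 : 0 < r := by positivity
  have hconj : (1 + ν).HolderConjugate r := by
    rw [Real.holderConjugate_iff]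
    refine ⟨by linarith, ?_⟩
    rw [hr]; field_simp
  have hS0 : 0 ≤ ∑ a, P a := Finset.sum_nonneg fun a _ => hP a
  have hsplit : ∀ a, P a = P a ^ (1 / (1 + ν)) * P a ^ (1 / r) := by
    intro a
    rw [← Real.rpow_add_of_nonneg (hP a) (by positivity) (by positivity)]
    have : 1 / (1 + ν) + 1 / r = 1 := by rw [hr]; field_simp
    rw [this, Real.rpow_one]
  have h := Real.inner_le_Lp_mul_Lq_of_nonneg (s := Finset.univ)
    (f := fun a => P a ^ (1 / (1 + ν)) * W a) (g := fun a => P a ^ (1 / r) * t a) hconj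
    (fun a _ => mul_nonneg (Real.rpow_nonneg (hP a) _) (hW a))
    (fun a _ => mul_nonneg (Real.rpow_nonneg (hP a) _) (ht a))
  have e1 : ∀ a, P a ^ (1 / (1 + ν)) * W a * (P a ^ (1 / r) * t a) = P a * W a * t a := by
    intro a
    conv_rhs => rw [hsplit a]
    ring
  have e2 : ∀ a, (P a ^ (1 / (1 + ν)) * W a) ^ (1 + ν) = P a * W a ^ (1 + ν) := by
    intro a
    rw [Real.mul_rpow (Real.rpow_nonneg (hP a) _) (hW a), ← Real.rpow_mul (hP a),
      one_div_mul_cancel hν'.ne', Real.rpow_one]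
  have e3 : ∀ a, (P a ^ (1 / r) * t a) ^ r = P a * t a ^ r := by
    intro a
    rw [Real.mul_rpow (Real.rpow_nonneg (hP a) _) (ht a), ← Real.rpow_mul (hP a),
      one_div_mul_cancel hr0.ne', Real.rpow_one]
  simp only [e1, e2, e3] at h
  have hle1 : ∀ a, t a ^ r ≤ 1 := fun a => Real.rpow_le_one (ht a) (ht1 a) hr0.le
  have hηr0 : 0 ≤ η * r := by positivity
  have hηr : η * r ≤ 1 := by
    rw [hr]
    calc η * ((1 + ν) / ν) ≤ ν / 2 * ((1 + ν) / ν) := by gcongr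
      _ = (1 + ν) / 2 := by field_simp
      _ ≤ 1 := by linarith
  have hta' : t a₀ ^ r ≤ 1 - η * r / 2 := by
    have h1 : t a₀ ^ r ≤ Real.exp (-(η * r)) := by
      calc t a₀ ^ r ≤ Real.exp (-η) ^ r := Real.rpow_le_rpow (ht a₀) hta hr0.le
        _ = _ := by rw [← Real.exp_mul]; congr 1; ring
    have := half_le_one_sub_exp hηr0 hηr
    linarith
  have hsum : ∑ a, P a * t a ^ r ≤ (∑ a, P a) * Real.exp (-(κ * (η * r / 2))) := by
    have h1 : ∑ a, P a * t a ^ r ≤ (∑ a, P a) - P a₀ * (η * r / 2) := by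
      have h2 : P a₀ * (η * r / 2) ≤ ∑ a, P a * (1 - t a ^ r) := by
        refine le_trans ?_ (Finset.single_le_sum (f := fun a => P a * (1 - t a ^ r))
          (fun a _ => mul_nonneg (hP a) (by linarith [hle1 a])) (Finset.mem_univ a₀))
        exact mul_le_mul_of_nonneg_left (by linarith) (hP a₀)
      have h3 : ∑ a, P a * (1 - t a ^ r) = (∑ a, P a) - ∑ a, P a * t a ^ r := by
        rw [← Finset.sum_sub_distrib]; exact Finset.sum_congr rfl fun a _ => by ring
      linarith
    have h4 := Real.add_one_le_exp (-(κ * (η * r / 2)))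
    nlinarith
  have hgain : (∑ a, P a * t a ^ r) ^ (1 / r) ≤
      Real.exp (-(κ * η / 2)) * (∑ a, P a) ^ (ν / (1 + ν)) := by
    have hnn : 0 ≤ ∑ a, P a * t a ^ r :=
      Finset.sum_nonneg fun a _ => mul_nonneg (hP a) (Real.rpow_nonneg (ht a) _)
    calc (∑ a, P a * t a ^ r) ^ (1 / r)
        ≤ ((∑ a, P a) * Real.exp (-(κ * (η * r / 2)))) ^ (1 / r) :=
          Real.rpow_le_rpow hnn hsum (by positivity)
      _ = Real.exp (-(κ * η / 2)) * (∑ a, P a) ^ (ν / (1 + ν)) := by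
          rw [Real.mul_rpow hS0 (Real.exp_pos _).le, ← Real.exp_mul, mul_comm]
          congr 2
          · field_simp
          · rw [hr]; field_simp
  have hW0 : 0 ≤ (∑ a, P a * W a ^ (1 + ν)) ^ (1 / (1 + ν)) :=
    Real.rpow_nonneg (Finset.sum_nonneg fun a _ => mul_nonneg (hP a) (Real.rpow_nonneg (hW a) _)) _
  calc ∑ a, P a * W a * t a ≤ _ := h
    _ ≤ (∑ a, P a * W a ^ (1 + ν)) ^ (1 / (1 + ν)) *
        (Real.exp (-(κ * η / 2)) * (∑ a, P a) ^ (ν / (1 + ν))) := by gcongr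
    _ = _ := by ring

/-! ### Tensorization -/

/-- The masses `p true`, `p false` are both at least a `κ`-fraction of the total. -/
def SplitBalanced (κ : ℝ) (p : Bool → ℝ) : Prop := ∀ b, κ * ∑ a, p a ≤ p b

open Classical in
lemma coordinate_gain {P W m : Bool → ℝ} (hP : ∀ a, 0 ≤ P a) (hW : ∀ a, 0 ≤ W a)
    (hm : ∀ b, 0 ≤ m b) {κ ν : ℝ} (hκ : 0 < κ) (hκ1 : κ ≤ 1) (hν : 0 < ν) (hν1 : ν ≤ 1)
    (α : Bool → ℝ) (z : Bool → ℂ) :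
    ∑ a, P a * W a *
        ‖∑ b, (m b : ℂ) * Complex.exp ((α a * boolSign b : ℝ) * Complex.I) * z b‖ ^ (1 + ν) ≤
      Real.exp (-(if SplitBalanced κ P ∧ SplitBalanced κ m then
          ν * κ ^ 2 * Real.sin (α true - α false) ^ 2 / 32 else 0)) *
        (∑ a, P a) ^ (ν / (1 + ν)) * (∑ a, P a * W a ^ (1 + ν)) ^ (1 / (1 + ν)) *
        ((∑ b, m b) ^ ν * ∑ b, m b * ‖z b‖ ^ (1 + ν)) := by
  have hν' : 1 + ν ≠ 0 := by linarith
  set M := ∑ b, m b with hM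
  have hM0 : 0 ≤ M := Finset.sum_nonneg fun b _ => hm b
  have hR : 0 ≤ Real.exp (-(if SplitBalanced κ P ∧ SplitBalanced κ m then
          ν * κ ^ 2 * Real.sin (α true - α false) ^ 2 / 32 else 0)) *
        (∑ a, P a) ^ (ν / (1 + ν)) * (∑ a, P a * W a ^ (1 + ν)) ^ (1 / (1 + ν)) *
        (M ^ ν * ∑ b, m b * ‖z b‖ ^ (1 + ν)) := by
    have h1 : 0 ≤ ∑ a, P a := Finset.sum_nonneg fun a _ => hP a
    have h2 : 0 ≤ ∑ a, P a * W a ^ (1 + ν) :=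
      Finset.sum_nonneg fun a _ => mul_nonneg (hP a) (Real.rpow_nonneg (hW a) _)
    have h3 : 0 ≤ ∑ b, m b * ‖z b‖ ^ (1 + ν) :=
      Finset.sum_nonneg fun a _ => mul_nonneg (hm a) (by positivity)
    positivity
  rcases hM0.eq_or_lt with hM' | hM'
  · have hm0 : ∀ b, m b = 0 := fun b =>
      (Finset.sum_eq_zero_iff_of_nonneg fun b _ => hm b).1 hM'.symm b (Finset.mem_univ b)
    refine le_of_eq_of_le ?_ hR
    simp [hm0, Real.zero_rpow hν']
  set q : Bool → ℝ := fun b => m b / M with hqdef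
  have hq0 : ∀ b, 0 ≤ q b := fun b => div_nonneg (hm b) hM0
  have hq1 : ∑ b, q b = 1 := by rw [← Finset.sum_div]; exact div_self hM'.ne'
  set T := ∑ b, q b * ‖z b‖ ^ (1 + ν) with hT
  set h : Bool → ℝ := fun a =>
    ‖∑ b, (q b : ℂ) * Complex.exp ((α a * boolSign b : ℝ) * Complex.I) * z b‖ ^ (1 + ν) with hh
  have hh0 : ∀ a, 0 ≤ h a := fun a => Real.rpow_nonneg (norm_nonneg _) _
  have hhT : ∀ a, h a ≤ T := fun a =>
    (Real.rpow_le_rpow (norm_nonneg _) (norm_sum_le_mean hq0 _ z) (by linarith)).trans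
      (mean_rpow_le hq0 hq1 (fun b => norm_nonneg _) hν)
  have hscale : ∀ a,
      ‖∑ b, (m b : ℂ) * Complex.exp ((α a * boolSign b : ℝ) * Complex.I) * z b‖ ^ (1 + ν) =
        M ^ (1 + ν) * h a := by
    intro a
    rw [hh, ← Real.mul_rpow hM0 (norm_nonneg _)]
    congr 1
    have hMn : M = ‖(M : ℂ)‖ := by rw [Complex.norm_real, Real.norm_of_nonneg hM0]
    conv_rhs => rw [hMn, ← norm_mul, Finset.mul_sum]
    congr 1
    refine Finset.sum_congr rfl fun b _ => ?_
    have : (m b : ℂ) = (M : ℂ) * (q b : ℂ) := by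
      rw [← Complex.ofReal_mul]; congr 1; rw [hqdef]; field_simp
    rw [this]; ring
  have hMT : M ^ (1 + ν) * T = M ^ ν * ∑ b, m b * ‖z b‖ ^ (1 + ν) := by
    rw [Real.rpow_add hM', Real.rpow_one, mul_comm M, mul_assoc, hT, Finset.mul_sum]
    congr 1
    refine Finset.sum_congr rfl fun b _ => ?_
    rw [hqdef]; field_simp
  simp only [hscale]
  rw [← hMT] at hR ⊢
  have hT0 : 0 ≤ T := (hh0 true).trans (hhT true)
  rcases hT0.eq_or_lt with hT' | hT'
  · refine le_of_eq_of_le ?_ hR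
    refine Finset.sum_eq_zero fun a _ => ?_
    rw [le_antisymm (hT' ▸ hhT a) (hh0 a)]; ring
  have hsin0 := sq_nonneg (Real.sin (α true - α false))
  have hsin1 := Real.sin_sq_le_one (α true - α false)
  have main : ∑ a, P a * W a * (h a / T) ≤
      Real.exp (-(if SplitBalanced κ P ∧ SplitBalanced κ m then
          ν * κ ^ 2 * Real.sin (α true - α false) ^ 2 / 32 else 0)) *
        (∑ a, P a) ^ (ν / (1 + ν)) * (∑ a, P a * W a ^ (1 + ν)) ^ (1 / (1 + ν)) := by
    have ht0 : ∀ a, 0 ≤ h a / T := fun a => div_nonneg (hh0 a) hT0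
    have ht1 : ∀ a, h a / T ≤ 1 := fun a => (div_le_one hT').2 (hhT a)
    split_ifs with hbal
    · obtain ⟨a₀, ha₀⟩ := exists_phase_gain hκ (q := q) (ν := ν) (fun b => by
        rw [hqdef]; exact (le_div_iff₀ hM').2 (hbal.2 b)) hq1 hν α z
      have := sum_mul_le_holder_gain hP hW ht0 ht1 (κ := κ) hν hν1
        (η := ν * κ * Real.sin (α true - α false) ^ 2 / 16) (by positivity)
        (by
          have : ν * κ * Real.sin (α true - α false) ^ 2 ≤ ν * 1 * 1 := by gcongr
          linarith) a₀ (hbal.1 a₀) ((div_le_iff₀ hT').2 ha₀)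
      convert this using 4
      ring
    · have := sum_mul_le_holder_gain hP hW ht0 ht1 (κ := 0) hν hν1 (η := 0) le_rfl
        (by positivity) true (by simpa using hP true) (by simpa using ht1 true)
      simpa using this
  calc ∑ a, P a * W a * (M ^ (1 + ν) * h a)
      = (∑ a, P a * W a * (h a / T)) * (M ^ (1 + ν) * T) := by
        rw [Finset.sum_mul]
        refine Finset.sum_congr rfl fun a _ => ?_
        field_simp
    _ ≤ _ := mul_le_mul_of_nonneg_right main (by positivity)

/-- `LateBranch κ P x j`: under the weight `P`, the conditional law of the `j`-th coordinate given
that the coordinates after `j` agree with `x` is `κ`-balanced. Thus `x 0` is revealed last. -/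
def LateBranch (κ : ℝ) : ∀ {n : ℕ}, ((Fin n → Bool) → ℝ) → (Fin n → Bool) → Fin n → Prop
  | 0, _, _ => fun j => j.elim0
  | _ + 1, P, x => Fin.cons (α := fun _ => Prop) (SplitBalanced κ fun a => P (Fin.cons a (Fin.tail x)))
      (LateBranch κ (fun x' => ∑ a, P (Fin.cons a x')) (Fin.tail x))

/-- `EarlyBranch κ g y j`: under the weight `g`, the conditional law of the `j`-th coordinate given
that the coordinates before `j` agree with `y` is `κ`-balanced. Thus `y 0` is revealed first. -/
def EarlyBranch (κ : ℝ) : ∀ {n : ℕ}, ((Fin n → Bool) → ℝ) → (Fin n → Bool) → Fin n → Prop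
  | 0, _, _ => fun j => j.elim0
  | _ + 1, g, y => Fin.cons (α := fun _ => Prop) (SplitBalanced κ fun b => ∑ y', g (Fin.cons b y'))
      (EarlyBranch κ (fun y' => g (Fin.cons (y 0) y')) (Fin.tail y))

/-- The exponential sum `∑ y, g y exp(i ∑ j, ±α j (x j))`, the signs being those of `y`. -/
noncomputable def signSum {n : ℕ} (α : Fin n → Bool → ℝ) (g : (Fin n → Bool) → ℝ)
    (x : Fin n → Bool) : ℂ :=
  ∑ y, (g y : ℂ) * Complex.exp ((∑ j, α j (x j) * boolSign (y j) : ℝ) * Complex.I)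

open Classical in
/-- The total decay collected from the coordinates where both `I` and `J` hold. -/
noncomputable def decay {n : ℕ} (κ ν : ℝ) (α : Fin n → Bool → ℝ) (I J : Fin n → Prop) : ℝ :=
  ∑ j, if I j ∧ J j then ν * κ ^ 2 * Real.sin (α j true - α j false) ^ 2 / 32 else 0

lemma sum_cube_zero {M : Type*} [AddCommMonoid M] (F : (Fin 0 → Bool) → M) :
    ∑ x, F x = F Fin.elim0 := by
  rw [Fintype.sum_unique]
  exact congrArg F (Subsingleton.elim _ _)

lemma sum_cube_succ {M : Type*} [AddCommMonoid M] {n : ℕ} (F : (Fin (n + 1) → Bool) → M) :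
    ∑ x, F x = ∑ x', ∑ a, F (Fin.cons a x') := by
  rw [← (Fin.consEquiv fun _ => Bool).sum_comp, Fintype.sum_prod_type_right]
  rfl

lemma signSum_cons {n : ℕ} (α : Fin (n + 1) → Bool → ℝ) (g : (Fin (n + 1) → Bool) → ℝ) (a : Bool)
    (x : Fin n → Bool) :
    signSum α g (Fin.cons a x) = ∑ b, Complex.exp ((α 0 a * boolSign b : ℝ) * Complex.I) *
      signSum (Fin.tail α) (fun y => g (Fin.cons b y)) x := by
  unfold signSum
  rw [sum_cube_succ, Finset.sum_comm]
  refine Finset.sum_congr rfl fun b _ => ?_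
  rw [Finset.mul_sum]
  refine Finset.sum_congr rfl fun y _ => ?_
  rw [Fin.sum_univ_succ]
  simp only [Fin.cons_zero, Fin.cons_succ, Fin.tail]
  rw [Complex.ofReal_add, add_mul, Complex.exp_add]
  ring

lemma decay_cons {n : ℕ} (κ ν : ℝ) (α : Fin (n + 1) → Bool → ℝ) (p q : Prop) (I J : Fin n → Prop)
    [Decidable (p ∧ q)] :
    decay κ ν α (Fin.cons (α := fun _ => Prop) p I) (Fin.cons (α := fun _ => Prop) q J) =
      (if p ∧ q then ν * κ ^ 2 * Real.sin (α 0 true - α 0 false) ^ 2 / 32 else 0) +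
        decay κ ν (Fin.tail α) I J := by
  unfold decay
  rw [Fin.sum_univ_succ]
  simp only [Fin.cons_zero, Fin.cons_succ, Fin.tail]
  congr 1

open Classical in
/-- Peeling off one coordinate at a time, in opposite orders for the two variables: the weight `W`
carries the gains already collected, and passing from `W` to its `L^{1+ν}`-mean absorbs its
variation along the coordinate being summed out. -/
theorem sum_signSum_rpow_le {κ ν : ℝ} (hκ : 0 < κ) (hκ1 : κ ≤ 1) (hν : 0 < ν) (hν1 : ν ≤ 1) :
    ∀ {n : ℕ} (α : Fin n → Bool → ℝ) (P W g : (Fin n → Bool) → ℝ), (∀ x, 0 ≤ P x) →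
      (∀ x, 0 ≤ W x) → (∀ y, 0 ≤ g y) →
      ∑ x, P x * W x * ‖signSum α g x‖ ^ (1 + ν) ≤
        (∑ y, g y) ^ ν * ∑ y, g y * ((∑ x, P x) ^ (ν / (1 + ν)) *
          (∑ x, P x * W x ^ (1 + ν) *
            Real.exp (-decay κ ν α (LateBranch κ P x) (EarlyBranch κ g y))) ^ (1 / (1 + ν)))
  | 0, α, P, W, g, hP, hW, hg => by
    have hν' : (0 : ℝ) < 1 + ν := by linarith
    simp only [sum_cube_zero, signSum, decay]
    simp only [univ_eq_empty, sum_empty, Complex.ofReal_zero, zero_mul, Complex.exp_zero, mul_one,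
      neg_zero, Real.exp_zero, Complex.norm_real, Real.norm_eq_abs]
    have h1 := hP Fin.elim0
    have h2 := hW Fin.elim0
    have h3 := hg Fin.elim0
    rw [abs_of_nonneg h3, Real.mul_rpow h1 (by positivity), ← Real.rpow_mul h2,
      mul_one_div_cancel hν'.ne', Real.rpow_one, ← mul_assoc (_ ^ (ν / (1 + ν))),
      ← Real.rpow_add_of_nonneg h1 (by positivity) (by positivity)]
    have : ν / (1 + ν) + 1 / (1 + ν) = 1 := by field_simp; ring
    rw [this, Real.rpow_one, Real.rpow_add_of_nonneg h3 zero_le_one hν.le, Real.rpow_one]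
    apply le_of_eq; ring
  | n + 1, α, P, W, g, hP, hW, hg => by
    have hν' : (0 : ℝ) < 1 + ν := by linarith
    set m : Bool → ℝ := fun b => ∑ y', g (Fin.cons b y') with hm
    have hm0 : ∀ b, 0 ≤ m b := fun b => Finset.sum_nonneg fun y _ => hg _
    have hmsum : ∑ b, m b = ∑ y, g y := by rw [sum_cube_succ, Finset.sum_comm]
    set P' : (Fin n → Bool) → ℝ := fun x => ∑ a, P (Fin.cons a x) with hP'
    have hP'0 : ∀ x, 0 ≤ P' x := fun x => Finset.sum_nonneg fun a _ => hP _
    have hP'sum : ∑ x, P' x = ∑ x, P x := by rw [sum_cube_succ]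
    set γ : (Fin n → Bool) → ℝ := fun x =>
      if SplitBalanced κ (fun a => P (Fin.cons a x)) ∧ SplitBalanced κ m then
        ν * κ ^ 2 * Real.sin (α 0 true - α 0 false) ^ 2 / 32 else 0 with hγ
    have hγ0 : ∀ x, 0 ≤ γ x := by
      intro x; simp only [hγ]; split_ifs <;> positivity
    set V : (Fin n → Bool) → ℝ := fun x => ∑ a, P (Fin.cons a x) * W (Fin.cons a x) ^ (1 + ν)
      with hV
    have hV0 : ∀ x, 0 ≤ V x := fun x =>
      Finset.sum_nonneg fun a _ => mul_nonneg (hP _) (Real.rpow_nonneg (hW _) _)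
    have hVP : ∀ x, P' x = 0 → V x = 0 := by
      intro x hx
      have := (Finset.sum_eq_zero_iff_of_nonneg fun a _ => hP _).1 hx
      exact Finset.sum_eq_zero fun a ha => by rw [this a ha, zero_mul]
    -- Where `P' x = 0` the quotient is `0`, which is harmless as `V x = 0` there too.
    set W' : (Fin n → Bool) → ℝ := fun x => Real.exp (-γ x) * (V x / P' x) ^ (1 / (1 + ν)) with hW'
    have hW'0 : ∀ x, 0 ≤ W' x := fun x =>
      mul_nonneg (Real.exp_pos _).le (Real.rpow_nonneg (div_nonneg (hV0 x) (hP'0 x)) _)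
    have hPW : ∀ x, Real.exp (-γ x) * P' x ^ (ν / (1 + ν)) * V x ^ (1 / (1 + ν)) = P' x * W' x := by
      intro x
      rcases (hP'0 x).eq_or_lt with h | h
      · rw [hVP x h.symm, ← h, Real.zero_rpow (by positivity)]; ring
      · simp only [hW']
        rw [Real.div_rpow (hV0 x) h.le]
        have : P' x = P' x ^ (ν / (1 + ν)) * P' x ^ (1 / (1 + ν)) := by
          rw [← Real.rpow_add h]
          have : ν / (1 + ν) + 1 / (1 + ν) = 1 := by field_simp; ring
          rw [this, Real.rpow_one]
        have h2 : P' x ^ (1 / (1 + ν)) ≠ 0 := (Real.rpow_pos_of_pos h _).ne'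
        calc _ = P' x ^ (ν / (1 + ν)) * P' x ^ (1 / (1 + ν)) *
              (Real.exp (-γ x) * (V x ^ (1 / (1 + ν)) / P' x ^ (1 / (1 + ν)))) := by field_simp
          _ = _ := by rw [← this]
    have hPWr : ∀ x, P' x * W' x ^ (1 + ν) ≤ Real.exp (-γ x) * V x := by
      intro x
      rcases (hP'0 x).eq_or_lt with h | h
      · rw [hVP x h.symm, ← h]; simp
      · simp only [hW']
        rw [Real.mul_rpow (Real.exp_pos _).le (Real.rpow_nonneg (div_nonneg (hV0 x) h.le) _),
          ← Real.rpow_mul (div_nonneg (hV0 x) h.le), one_div_mul_cancel hν'.ne', Real.rpow_one,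
          ← Real.exp_mul]
        have h1 : Real.exp (-γ x * (1 + ν)) ≤ Real.exp (-γ x) :=
          Real.exp_le_exp.2 (by nlinarith [hγ0 x])
        calc P' x * (Real.exp (-γ x * (1 + ν)) * (V x / P' x))
            = Real.exp (-γ x * (1 + ν)) * V x := by field_simp
          _ ≤ _ := mul_le_mul_of_nonneg_right h1 (hV0 x)
    -- The normalized sum on the branch `b`. If `m b = 0`, both the sum and the quotient are `0`.
    set z : Bool → (Fin n → Bool) → ℂ := fun b x =>
      signSum (Fin.tail α) (fun y => g (Fin.cons b y)) x / m b with hz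
    have hmz : ∀ b x, (m b : ℂ) * z b x = signSum (Fin.tail α) (fun y => g (Fin.cons b y)) x := by
      intro b x
      rcases eq_or_ne (m b) 0 with h | h
      · have h0 := (Finset.sum_eq_zero_iff_of_nonneg fun y _ => hg _).1 h
        rw [h, Complex.ofReal_zero, zero_mul, signSum]
        exact (Finset.sum_eq_zero fun y hy => by rw [h0 y hy]; simp).symm
      · simp only [hz]
        have : (m b : ℂ) ≠ 0 := by exact_mod_cast h
        field_simp
    have step : ∀ x, ∑ a, P (Fin.cons a x) * W (Fin.cons a x) *
        ‖signSum α g (Fin.cons a x)‖ ^ (1 + ν) ≤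
        P' x * W' x * ((∑ y, g y) ^ ν * ∑ b, m b * ‖z b x‖ ^ (1 + ν)) := by
      intro x
      have h := coordinate_gain (P := fun a => P (Fin.cons a x)) (W := fun a => W (Fin.cons a x))
        (fun a => hP _) (fun a => hW _) hm0 hκ hκ1 hν hν1 (α 0) (fun b => z b x)
      rw [← hPW x, ← hmsum]
      refine le_of_eq_of_le (Finset.sum_congr rfl fun a _ => ?_) h
      rw [signSum_cons]
      congr 3
      refine Finset.sum_congr rfl fun b _ => ?_
      rw [← hmz b x]; ring
    have hbranch : ∀ b, ∑ x, P' x * W' x * (m b * ‖z b x‖ ^ (1 + ν)) ≤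
        ∑ y, g (Fin.cons b y) * ((∑ x, P x) ^ (ν / (1 + ν)) *
          (∑ x, P x * W x ^ (1 + ν) * Real.exp (-decay κ ν α (LateBranch κ P x)
            (EarlyBranch κ g (Fin.cons b y)))) ^ (1 / (1 + ν))) := by
      intro b
      have hPs0 : 0 ≤ ∑ x, P x := Finset.sum_nonneg fun x _ => hP x
      have hin0 : ∀ y, 0 ≤ ∑ x, P x * W x ^ (1 + ν) * Real.exp (-decay κ ν α (LateBranch κ P x)
            (EarlyBranch κ g (Fin.cons b y))) := fun y =>
        Finset.sum_nonneg fun x _ => mul_nonneg (mul_nonneg (hP x) (Real.rpow_nonneg (hW x) _))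
          (Real.exp_pos _).le
      rcases (hm0 b).eq_or_lt with h | h
      · rw [← h]
        simp only [zero_mul, mul_zero, Finset.sum_const_zero]
        exact Finset.sum_nonneg fun y _ => mul_nonneg (hg _)
          (mul_nonneg (Real.rpow_nonneg hPs0 _) (Real.rpow_nonneg (hin0 y) _))
      have ih := sum_signSum_rpow_le hκ hκ1 hν hν1 (Fin.tail α) P' W' (fun y => g (Fin.cons b y))
        hP'0 hW'0 (fun y => hg _)
      have e1 : ∀ x, P' x * W' x * (m b * ‖z b x‖ ^ (1 + ν)) = (m b ^ ν)⁻¹ *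
          (P' x * W' x * ‖signSum (Fin.tail α) (fun y => g (Fin.cons b y)) x‖ ^ (1 + ν)) := by
        intro x
        rw [← hmz b x, norm_mul, Complex.norm_real, Real.norm_of_nonneg h.le,
          Real.mul_rpow h.le (norm_nonneg _), Real.rpow_add h, Real.rpow_one]
        have : m b ^ ν ≠ 0 := (Real.rpow_pos_of_pos h _).ne'
        field_simp
      simp only [e1]
      rw [← Finset.mul_sum, inv_mul_le_iff₀ (Real.rpow_pos_of_pos h _)]
      refine ih.trans ?_
      rw [hP'sum]
      have hin'0 : ∀ y, 0 ≤ ∑ x, P' x * W' x ^ (1 + ν) *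
          Real.exp (-decay κ ν (Fin.tail α) (LateBranch κ P' x)
            (EarlyBranch κ (fun y => g (Fin.cons b y)) y)) := fun y =>
        Finset.sum_nonneg fun x _ => mul_nonneg (mul_nonneg (hP'0 x)
          (Real.rpow_nonneg (hW'0 x) _)) (Real.exp_pos _).le
      refine mul_le_mul_of_nonneg_left (Finset.sum_le_sum fun y _ => mul_le_mul_of_nonneg_left
        (mul_le_mul_of_nonneg_left (Real.rpow_le_rpow (hin'0 y) ?_ (by positivity))
          (Real.rpow_nonneg hPs0 _)) (hg _)) (Real.rpow_nonneg (hm0 b) _)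
      · rw [sum_cube_succ (fun x => P x * _ * _)]
        refine Finset.sum_le_sum fun x _ => ?_
        have e2 : ∀ a, decay κ ν α (LateBranch κ P (Fin.cons a x))
            (EarlyBranch κ g (Fin.cons b y)) = γ x + decay κ ν (Fin.tail α) (LateBranch κ P' x)
              (EarlyBranch κ (fun y => g (Fin.cons b y)) y) := by
          intro a
          simp only [LateBranch, EarlyBranch, Fin.tail_cons, Fin.cons_zero]
          rw [decay_cons]
        simp only [e2, neg_add, Real.exp_add]
        simp only [← mul_assoc]
        rw [← Finset.sum_mul, ← Finset.sum_mul]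
        exact mul_le_mul_of_nonneg_right ((hPWr x).trans_eq (mul_comm _ _)) (Real.exp_pos _).le
    rw [sum_cube_succ]
    calc _ ≤ ∑ x, P' x * W' x * ((∑ y, g y) ^ ν * ∑ b, m b * ‖z b x‖ ^ (1 + ν)) :=
          Finset.sum_le_sum fun x _ => step x
      _ = (∑ y, g y) ^ ν * ∑ b, ∑ x, P' x * W' x * (m b * ‖z b x‖ ^ (1 + ν)) := by
          rw [Finset.sum_comm, Finset.mul_sum]
          refine Finset.sum_congr rfl fun x _ => ?_
          rw [← Finset.mul_sum]; ring
      _ ≤ _ := by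
          rw [sum_cube_succ (fun y => g y * _), Finset.sum_comm (s := Finset.univ (α := Fin n → Bool))]
          have : 0 ≤ (∑ y, g y) := Finset.sum_nonneg fun y _ => hg y
          refine mul_le_mul_of_nonneg_left (Finset.sum_le_sum fun b _ => ?_)
            (Real.rpow_nonneg this _)
          exact hbranch b

/-! ### Counting branching coordinates -/

open Classical in
lemma split_sqrt_le {κ : ℝ} (hκ : 0 ≤ κ) {p : Bool → ℝ} (hp : ∀ a, 0 ≤ p a) :
    (if SplitBalanced κ p then (Real.sqrt 2)⁻¹ else 1) * ∑ a, Real.sqrt (p a) ≤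
      (1 + Real.sqrt κ) * Real.sqrt (∑ a, p a) := by
  have hS : 0 ≤ ∑ a, p a := Finset.sum_nonneg fun a _ => hp a
  have hκ' := Real.sqrt_nonneg κ
  split_ifs with h
  · have h1 : ∑ a, Real.sqrt (p a) ≤ Real.sqrt 2 * Real.sqrt (∑ a, p a) := by
      rw [← Real.sqrt_mul (by norm_num)]
      apply Real.le_sqrt_of_sq_le
      rw [Fintype.sum_bool, Fintype.sum_bool]
      nlinarith [Real.sq_sqrt (hp true), Real.sq_sqrt (hp false),
        sq_nonneg (Real.sqrt (p true) - Real.sqrt (p false))]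
    rw [inv_mul_le_iff₀ (by positivity)]
    refine h1.trans ?_
    have : 0 ≤ Real.sqrt κ * (Real.sqrt 2 * Real.sqrt (∑ a, p a)) := by positivity
    linarith
  · simp only [SplitBalanced, not_forall, not_le] at h
    obtain ⟨b, hb⟩ := h
    have h1 : Real.sqrt (p b) ≤ Real.sqrt κ * Real.sqrt (∑ a, p a) := by
      rw [← Real.sqrt_mul hκ]; exact Real.sqrt_le_sqrt hb.le
    have h2 : Real.sqrt (p !b) ≤ Real.sqrt (∑ a, p a) :=
      Real.sqrt_le_sqrt (Finset.single_le_sum (fun a _ => hp a) (Finset.mem_univ _))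
    have h3 : ∑ a, Real.sqrt (p a) = Real.sqrt (p b) + Real.sqrt (p !b) := by
      cases b <;> simp [add_comm]
    rw [h3]; linarith

open Classical in
lemma inv_sqrt_two_pow_cons {n : ℕ} (p : Prop) (I : Fin n → Prop) :
    (Real.sqrt 2)⁻¹ ^ #{j | Fin.cons (α := fun _ => Prop) p I j} =
      (if p then (Real.sqrt 2)⁻¹ else 1) * (Real.sqrt 2)⁻¹ ^ #{j | I j} := by
  rw [Fin.card_filter_univ_succ]
  simp only [Fin.cons_zero, Fin.cons_succ]
  split_ifs
  · rw [pow_succ, mul_comm]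
  · rw [one_mul]

open Classical in
/-- A set of size `N` in the cube cannot have typical points with much fewer than `log₂ N`
branching coordinates. -/
lemma sum_sqrt_lateBranch_le {κ : ℝ} (hκ : 0 ≤ κ) :
    ∀ {n : ℕ} (P : (Fin n → Bool) → ℝ), (∀ x, 0 ≤ P x) →
      ∑ x, Real.sqrt (P x) * (Real.sqrt 2)⁻¹ ^ #{j | LateBranch κ P x j} ≤
        (1 + Real.sqrt κ) ^ n * Real.sqrt (∑ x, P x)
  | 0, P, hP => by simp only [sum_cube_zero]; simp
  | n + 1, P, hP => by
    have ih := sum_sqrt_lateBranch_le hκ (fun x' => ∑ a, P (Fin.cons a x'))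
      fun x => Finset.sum_nonneg fun a _ => hP _
    rw [sum_cube_succ, sum_cube_succ P, pow_succ', mul_assoc]
    refine le_trans ?_ (mul_le_mul_of_nonneg_left ih (by positivity))
    rw [Finset.mul_sum]
    refine Finset.sum_le_sum fun x _ => ?_
    have h := split_sqrt_le hκ (p := fun a => P (Fin.cons a x)) fun a => hP _
    simp only [LateBranch, Fin.tail_cons, inv_sqrt_two_pow_cons, ← mul_assoc]
    rw [← Finset.sum_mul]
    refine mul_le_mul_of_nonneg_right ?_ (by positivity)
    rw [← Finset.sum_mul, mul_comm (∑ a, _)]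
    exact h

open Classical in
lemma sum_sqrt_earlyBranch_le {κ : ℝ} (hκ : 0 ≤ κ) :
    ∀ {n : ℕ} (g : (Fin n → Bool) → ℝ), (∀ y, 0 ≤ g y) →
      ∑ y, Real.sqrt (g y) * (Real.sqrt 2)⁻¹ ^ #{j | EarlyBranch κ g y j} ≤
        (1 + Real.sqrt κ) ^ n * Real.sqrt (∑ y, g y)
  | 0, g, hg => by simp only [sum_cube_zero]; simp
  | n + 1, g, hg => by
    rw [sum_cube_succ, sum_cube_succ g, Finset.sum_comm, Finset.sum_comm (f := fun x a => g _)]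
    have h := split_sqrt_le hκ (p := fun b => ∑ y, g (Fin.cons b y))
      fun b => Finset.sum_nonneg fun y _ => hg _
    set c : ℝ := if SplitBalanced κ (fun b => ∑ y, g (Fin.cons b y)) then (Real.sqrt 2)⁻¹ else 1
      with hc
    have hc0 : 0 ≤ c := by rw [hc]; split_ifs <;> positivity
    calc _ ≤ ∑ b, c * ((1 + Real.sqrt κ) ^ n * Real.sqrt (∑ y, g (Fin.cons b y))) := by
          refine Finset.sum_le_sum fun b _ => ?_
          have ih := sum_sqrt_earlyBranch_le hκ (fun y => g (Fin.cons b y)) fun y => hg _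
          refine le_trans (le_of_eq ?_) (mul_le_mul_of_nonneg_left ih hc0)
          rw [Finset.mul_sum]
          refine Finset.sum_congr rfl fun y _ => ?_
          simp only [EarlyBranch, Fin.tail_cons, Fin.cons_zero, inv_sqrt_two_pow_cons]
          rw [← hc]; ring
      _ = (1 + Real.sqrt κ) ^ n * (c * ∑ b, Real.sqrt (∑ y, g (Fin.cons b y))) := by
          rw [Finset.mul_sum, Finset.mul_sum]
          exact Finset.sum_congr rfl fun b _ => by ring
      _ ≤ _ := by
          rw [pow_succ, mul_assoc]
          exact mul_le_mul_of_nonneg_left h (by positivity)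

lemma inv_sqrt_two_pow (k : ℕ) : (Real.sqrt 2)⁻¹ ^ k = (2 : ℝ) ^ (-((k : ℝ) / 2)) := by
  rw [Real.sqrt_eq_rpow, ← Real.rpow_neg (by norm_num), ← Real.rpow_natCast, ← Real.rpow_mul
    (by norm_num)]
  congr 1; ring

/-- Markov's inequality for the weights `2 ^ (-c x / 2)` on a set `S`, encoded by its indicator. -/
lemma card_filter_lt_le {ι : Type*} [Fintype ι] [DecidableEq ι] (S : Finset ι) (c : ι → ℕ)
    {K τ : ℝ}
    (h : ∑ x, Real.sqrt (if x ∈ S then (1 : ℝ) else 0) * (Real.sqrt 2)⁻¹ ^ c x ≤ K) :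
    (#{x ∈ S | (c x : ℝ) < τ} : ℝ) ≤ K * (2 : ℝ) ^ (τ / 2) := by
  have h1 : (#{x ∈ S | (c x : ℝ) < τ} : ℝ) * (2 : ℝ) ^ (-(τ / 2)) ≤ K := by
    refine le_trans ?_ h
    rw [← nsmul_eq_mul, ← Finset.sum_const]
    refine le_trans (Finset.sum_le_sum (g := fun x =>
      Real.sqrt (if x ∈ S then (1 : ℝ) else 0) * (Real.sqrt 2)⁻¹ ^ c x) fun x hx => ?_)
      (Finset.sum_le_sum_of_subset_of_nonneg (Finset.subset_univ _) fun x _ _ => by positivity)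
    rw [Finset.mem_filter] at hx
    rw [if_pos hx.1, Real.sqrt_one, one_mul, inv_sqrt_two_pow]
    exact Real.rpow_le_rpow_of_exponent_le (by norm_num) (by linarith [hx.2])
  rwa [Real.rpow_neg (by norm_num), ← div_eq_mul_inv, div_le_iff₀ (by positivity)] at h1

/-- If `S` has at least `2 ^ (σ n)` points, all but an exponentially small fraction of its points
have at least `(σ - ε) n` branching coordinates, once `κ` is small enough in terms of `ε`. -/
lemma card_few_le {ι : Type*} [Fintype ι] [DecidableEq ι] {S : Finset ι} {c : ι → ℕ} {n : ℕ}
    {κ σ ε : ℝ} (hκε : 1 + Real.sqrt κ ≤ (2 : ℝ) ^ (ε / 4)) (hS : (2 : ℝ) ^ (σ * n) ≤ #S)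
    (h : ∑ x, Real.sqrt (if x ∈ S then (1 : ℝ) else 0) * (Real.sqrt 2)⁻¹ ^ c x ≤
      (1 + Real.sqrt κ) ^ n * Real.sqrt (∑ x, if x ∈ S then (1 : ℝ) else 0)) :
    (#{x ∈ S | (c x : ℝ) < (σ - ε) * n} : ℝ) ≤ (2 : ℝ) ^ (-(ε * n / 4)) * #S := by
  have hsum : (∑ x, if x ∈ S then (1 : ℝ) else 0) = #S := by
    rw [Finset.sum_ite_mem, Finset.univ_inter]; simp
  rw [hsum] at h
  refine (card_filter_lt_le S c h).trans ?_
  have h2 : (0 : ℝ) < 2 := by norm_num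
  have h1 : (1 + Real.sqrt κ) ^ n ≤ (2 : ℝ) ^ (ε * n / 4) := by
    calc (1 + Real.sqrt κ) ^ n ≤ ((2 : ℝ) ^ (ε / 4)) ^ n := by gcongr
      _ = _ := by rw [← Real.rpow_mul_natCast h2.le]; congr 1; ring
  have h3 : (2 : ℝ) ^ (σ * n / 2) ≤ Real.sqrt #S := by
    apply Real.le_sqrt_of_sq_le
    refine le_trans (le_of_eq ?_) hS
    rw [← Real.rpow_mul_natCast h2.le]; congr 1; push_cast; ring
  calc (1 + Real.sqrt κ) ^ n * Real.sqrt #S * (2 : ℝ) ^ ((σ - ε) * n / 2)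
      ≤ (2 : ℝ) ^ (ε * n / 4) * Real.sqrt #S * (2 : ℝ) ^ ((σ - ε) * n / 2) := by gcongr
    _ = (2 : ℝ) ^ (-(ε * n / 4)) * ((2 : ℝ) ^ (σ * n / 2) * Real.sqrt #S) := by
        have : (2 : ℝ) ^ (ε * n / 4) * (2 : ℝ) ^ ((σ - ε) * n / 2) =
            (2 : ℝ) ^ (-(ε * n / 4)) * (2 : ℝ) ^ (σ * n / 2) := by
          rw [← Real.rpow_add h2, ← Real.rpow_add h2]; congr 1; ring
        linear_combination Real.sqrt #S * this
    _ ≤ (2 : ℝ) ^ (-(ε * n / 4)) * (Real.sqrt #S * Real.sqrt #S) := by gcongr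
    _ = _ := by rw [Real.mul_self_sqrt (Nat.cast_nonneg _)]

/-! ### Small-value sets of quadratic sine sums modulo a prime -/

lemma zmod_intCast_ne_zero {N : ℕ} {z : ℤ} (hz : z ≠ 0) (hN : |z| < N) : (z : ZMod N) ≠ 0 := by
  intro h
  rw [ZMod.intCast_zmod_eq_zero_iff_dvd] at h
  exact hz (Int.eq_zero_of_abs_lt_dvd h hN)

lemma addChar_map_sum {A M ι : Type*} [AddCommMonoid A] [CommMonoid M] (χ : AddChar A M)
    (s : Finset ι) (f : ι → A) : χ (∑ i ∈ s, f i) = ∏ i ∈ s, χ (f i) := by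
  classical
  induction s using Finset.induction_on with
  | empty => simp
  | insert i s hi ih =>
    rw [Finset.sum_insert hi, Finset.prod_insert hi, AddChar.map_add_eq_mul, ih]

section Halasz

variable {n N : ℕ} [NeZero N]

/-- `∑ j ∈ J, sin² (2π k dⱼ / N)`. -/
noncomputable def sineEnergy (d : Fin n → ℤ) (J : Finset (Fin n)) (k : ZMod N) : ℝ :=
  ∑ j ∈ J, (ZMod.stdAddChar (k * (d j : ZMod N))).im ^ 2

/-- The residues `k` at which the sine energy is at most `τ ^ 2`. -/
noncomputable def energyBall (d : Fin n → ℤ) (J : Finset (Fin n)) (τ : ℝ) : Finset (ZMod N) :=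
  {k | sineEnergy d J k ≤ τ ^ 2}

lemma stdAddChar_normSq (m : ZMod N) :
    (ZMod.stdAddChar m).re ^ 2 + (ZMod.stdAddChar m).im ^ 2 = 1 := by
  have h : Complex.normSq (ZMod.stdAddChar m) = 1 := by
    rw [Complex.normSq_eq_norm_sq, AddChar.norm_apply, one_pow]
  rw [Complex.normSq_apply] at h
  linarith

lemma abs_im_stdAddChar_add_le (a b : ZMod N) :
    |(ZMod.stdAddChar (a + b)).im| ≤ |(ZMod.stdAddChar a).im| + |(ZMod.stdAddChar b).im| := by
  rw [AddChar.map_add_eq_mul, Complex.mul_im]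
  have h : ∀ m : ZMod N, |(ZMod.stdAddChar m).re| ≤ 1 := fun m =>
    (Complex.abs_re_le_norm _).trans (AddChar.norm_apply _ _).le
  refine (abs_add_le _ _).trans ?_
  rw [abs_mul, abs_mul, add_comm]
  exact add_le_add (mul_le_of_le_one_right (abs_nonneg _) (h b))
    (mul_le_of_le_one_left (abs_nonneg _) (h a))

lemma re_stdAddChar_two_mul (m : ZMod N) :
    (ZMod.stdAddChar (2 * m)).re = 1 - 2 * (ZMod.stdAddChar m).im ^ 2 := by
  rw [two_mul, AddChar.map_add_eq_mul, Complex.mul_re]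
  linarith [stdAddChar_normSq m]

/-- The square root of the sine energy is subadditive. -/
lemma sineEnergy_add_le (d : Fin n → ℤ) (J : Finset (Fin n)) {a b : ZMod N} {x y : ℝ}
    (hx : 0 ≤ x) (hy : 0 ≤ y) (ha : sineEnergy d J a ≤ x ^ 2) (hb : sineEnergy d J b ≤ y ^ 2) :
    sineEnergy d J (a + b) ≤ (x + y) ^ 2 := by
  unfold sineEnergy at *
  set f : Fin n → ℝ := fun j => |(ZMod.stdAddChar (a * (d j : ZMod N))).im|
  set g : Fin n → ℝ := fun j => |(ZMod.stdAddChar (b * (d j : ZMod N))).im|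
  have hf : ∑ j ∈ J, f j ^ 2 ≤ x ^ 2 := by simpa only [f, sq_abs] using ha
  have hg : ∑ j ∈ J, g j ^ 2 ≤ y ^ 2 := by simpa only [g, sq_abs] using hb
  have hfg : ∑ j ∈ J, f j * g j ≤ x * y := by
    apply le_of_sq_le_sq _ (by positivity)
    refine (Finset.sum_mul_sq_le_sq_mul_sq J f g).trans ?_
    rw [mul_pow]
    exact mul_le_mul hf hg (Finset.sum_nonneg fun _ _ => sq_nonneg _) (sq_nonneg _)
  calc _ ≤ ∑ j ∈ J, (f j ^ 2 + 2 * (f j * g j) + g j ^ 2) := by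
        refine Finset.sum_le_sum fun j _ => ?_
        have h := abs_im_stdAddChar_add_le (a * (d j : ZMod N)) (b * (d j : ZMod N))
        rw [← add_mul] at h
        rw [← sq_abs]
        calc _ ≤ (f j + g j) ^ 2 := by gcongr
          _ = _ := by ring
    _ = ∑ j ∈ J, f j ^ 2 + 2 * ∑ j ∈ J, f j * g j + ∑ j ∈ J, g j ^ 2 := by
        rw [Finset.sum_add_distrib, Finset.sum_add_distrib, Finset.mul_sum]
    _ ≤ (x + y) ^ 2 := by nlinarith

lemma sineEnergy_nonneg (d : Fin n → ℤ) (J : Finset (Fin n)) (k : ZMod N) :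
    0 ≤ sineEnergy d J k := Finset.sum_nonneg fun _ _ => sq_nonneg _

lemma zero_mem_energyBall (d : Fin n → ℤ) (J : Finset (Fin n)) (τ : ℝ) :
    (0 : ZMod N) ∈ energyBall d J τ := by
  have h : sineEnergy (N := N) d J 0 = 0 := by simp [sineEnergy]
  simp only [energyBall, Finset.mem_filter, Finset.mem_univ, true_and, h]
  positivity

lemma energyBall_mono (d : Fin n → ℤ) (J : Finset (Fin n)) {τ τ' : ℝ} (h0 : 0 ≤ τ) (h : τ ≤ τ') :
    energyBall (N := N) d J τ ⊆ energyBall d J τ' := by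
  intro k hk
  simp only [energyBall, Finset.mem_filter, Finset.mem_univ, true_and] at hk ⊢
  exact hk.trans (by gcongr)

open Pointwise in
/-- Small-value sets grow at least linearly, by the Cauchy–Davenport inequality. -/
lemma card_energyBall_mul (hN : N.Prime) (d : Fin n → ℤ) (J : Finset (Fin n)) {τ : ℝ} (hτ : 0 ≤ τ)
    (m : ℕ) :
    min (N + m) ((m + 1) * #(energyBall (N := N) d J τ)) ≤
      #(energyBall (N := N) d J ((m + 1 : ℕ) * τ)) + m := by
  induction m with
  | zero => simp
  | succ m ih =>
    have hsub : energyBall (N := N) d J ((m + 1 : ℕ) * τ) + energyBall d J τ ⊆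
        energyBall d J ((m + 1 + 1 : ℕ) * τ) := by
      intro k hk
      obtain ⟨a, ha, b, hb, rfl⟩ := Finset.mem_add.1 hk
      simp only [energyBall, Finset.mem_filter, Finset.mem_univ, true_and] at ha hb ⊢
      refine (sineEnergy_add_le d J (by positivity) hτ ha hb).trans (le_of_eq ?_)
      push_cast; ring
    have hcd := ZMod.cauchy_davenport hN ⟨_, zero_mem_energyBall d J ((m + 1 : ℕ) * τ)⟩
      ⟨_, zero_mem_energyBall (N := N) d J τ⟩
    have hc := Finset.card_le_card hsub
    have h1 : 0 < #(energyBall (N := N) d J τ) :=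
      Finset.card_pos.2 ⟨_, zero_mem_energyBall d J τ⟩
    have h2 : (m + 1 + 1) * #(energyBall (N := N) d J τ) =
      (m + 1) * #(energyBall (N := N) d J τ) + #(energyBall (N := N) d J τ) := by ring
    omega

lemma card_energyBall_le (hN : N.Prime) (d : Fin n → ℤ) (J : Finset (Fin n)) {τ T : ℝ} (hτ : 0 < τ)
    (hT : τ ≤ T) (hlt : #(energyBall (N := N) d J T) < N) :
    (#(energyBall (N := N) d J τ) : ℝ) ≤ 2 * (τ / T) * #(energyBall (N := N) d J T) + 1 := by
  have hT0 : 0 < T := hτ.trans_le hT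
  have h1 : 1 ≤ T / τ := (one_le_div hτ).2 hT
  obtain ⟨m, hm⟩ : ∃ m, ⌊T / τ⌋₊ = m + 1 :=
    ⟨⌊T / τ⌋₊ - 1, by have := (Nat.one_le_floor_iff _).2 h1; omega⟩
  have hle : ((m + 1 : ℕ) : ℝ) ≤ T / τ := hm ▸ Nat.floor_le (by positivity)
  have hge : T / τ < (m + 1 : ℕ) + 1 := hm ▸ Nat.lt_floor_add_one _
  have hsub := Finset.card_le_card (energyBall_mono (N := N) d J (τ := (m + 1 : ℕ) * τ) (τ' := T)
    (by positivity) ((le_div_iff₀ hτ).1 hle))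
  have hmul := card_energyBall_mul hN d J hτ.le m
  have hnat : (m + 1) * #(energyBall (N := N) d J τ) ≤ #(energyBall (N := N) d J T) + m := by
    omega
  have hreal : ((m : ℝ) + 1) * #(energyBall (N := N) d J τ) ≤ #(energyBall (N := N) d J T) + m := by
    exact_mod_cast hnat
  have hM : T / τ / 2 ≤ (m : ℝ) + 1 := by push_cast at hge; linarith [Nat.cast_nonneg (α := ℝ) m]
  have hMτ : 1 ≤ 2 * (τ / T) * ((m : ℝ) + 1) := by
    calc (1 : ℝ) = 2 * (τ / T) * (T / τ / 2) := by field_simp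
      _ ≤ _ := by gcongr
  have hm0 : (0 : ℝ) < (m : ℝ) + 1 := by positivity
  have hL : (0 : ℝ) ≤ #(energyBall (N := N) d J T) := Nat.cast_nonneg _
  refine le_of_mul_le_mul_left ?_ hm0
  nlinarith

lemma sum_re_stdAddChar_mul {m : ZMod N} (hm : m ≠ 0) :
    ∑ k : ZMod N, (ZMod.stdAddChar (k * m)).re = 0 := by
  have h := AddChar.sum_mulShift m (ZMod.isPrimitive_stdAddChar N)
  rw [if_neg hm] at h
  rw [← Complex.re_sum, h]; simp

lemma sum_sineEnergy {d : Fin n → ℤ} (J : Finset (Fin n)) (hd : ∀ j, d j ≠ 0)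
    (hN : ∀ j, |2 * d j| < N) : ∑ k : ZMod N, sineEnergy d J k = N * #J / 2 := by
  unfold sineEnergy
  rw [Finset.sum_comm]
  have h : ∀ j ∈ J, ∑ k : ZMod N, (ZMod.stdAddChar (k * (d j : ZMod N))).im ^ 2 = N / 2 := by
    intro j _
    have h0 := sum_re_stdAddChar_mul
      (zmod_intCast_ne_zero (mul_ne_zero two_ne_zero (hd j)) (hN j))
    have h1 : ∀ k : ZMod N, (ZMod.stdAddChar (k * ((2 * d j : ℤ) : ZMod N))).re =
        1 - 2 * (ZMod.stdAddChar (k * (d j : ZMod N))).im ^ 2 := by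
      intro k
      rw [← re_stdAddChar_two_mul]; congr 2; push_cast; ring
    simp only [h1, Finset.sum_sub_distrib, ← Finset.mul_sum] at h0
    simp only [Finset.sum_const, Finset.card_univ, ZMod.card, nsmul_eq_mul, mul_one] at h0
    linarith
  rw [Finset.sum_congr rfl h, Finset.sum_const, nsmul_eq_mul]; ring

/-- Below the average energy, the small-value set is not everything. -/
lemma card_energyBall_lt {d : Fin n → ℤ} {J : Finset (Fin n)}
    (hd : ∀ j, d j ≠ 0) (hN : ∀ j, |2 * d j| < N) {T : ℝ} (hT : T ^ 2 < #J / 2) :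
    #(energyBall (N := N) d J T) < N := by
  by_contra! h
  have hN0 : (0 : ℝ) < N := by exact_mod_cast Nat.pos_of_ne_zero (NeZero.ne N)
  have huniv : energyBall (N := N) d J T = Finset.univ := by
    apply Finset.eq_univ_of_card
    rw [ZMod.card]
    refine le_antisymm ?_ h
    simpa [ZMod.card] using Finset.card_le_univ (energyBall (N := N) d J T)
  have h1 : ∑ k : ZMod N, sineEnergy d J k ≤ ∑ _k : ZMod N, T ^ 2 := by
    refine Finset.sum_le_sum fun k _ => ?_
    have : k ∈ energyBall (N := N) d J T := huniv ▸ Finset.mem_univ k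
    simpa [energyBall] using this
  rw [sum_sineEnergy J hd hN] at h1
  simp only [Finset.sum_const, Finset.card_univ, ZMod.card, nsmul_eq_mul] at h1
  nlinarith

/-- The number of `(ε, j)` in `{±1}^m × [n]^m` with `ε₁ d_{j₁} + ⋯ + ε_m d_{j_m} = 0`. -/
def signedZeroSums (d : Fin n → ℤ) (m : ℕ) : ℕ :=
  #{p ∈ signCube m ×ˢ (univ : Finset (Fin m → Fin n)) | ∑ k, p.1 k * d (p.2 k) = 0}

/-- Moments of the cosine sum over `J` count signed zero sums with indices in `J`, once `N` is large. -/
lemma sum_cosine_pow_le {d : Fin n → ℤ} (J : Finset (Fin n)) (m : ℕ) {D : ℤ}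
    (hD : ∀ j, |d j| ≤ D) (hN : 2 * m * D < N) :
    ∑ k : ZMod N, (∑ j ∈ J, 2 * (ZMod.stdAddChar (k * ((2 * d j : ℤ) : ZMod N))).re) ^ m ≤
      N * signedZeroSums d m := by
  classical
  set Q : Finset (ℤ × Fin n) := ({1, -1} : Finset ℤ) ×ˢ J with hQ
  have hpt : ∀ k : ZMod N, (((∑ j ∈ J, 2 * (ZMod.stdAddChar (k * ((2 * d j : ℤ) : ZMod N))).re) ^ m : ℝ) : ℂ) =
      ∑ p ∈ Fintype.piFinset fun _ : Fin m => Q,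
        ZMod.stdAddChar (k * ((2 * ∑ i, (p i).1 * d (p i).2 : ℤ) : ZMod N)) := by
    intro k
    have h1 : ((∑ j ∈ J, 2 * (ZMod.stdAddChar (k * ((2 * d j : ℤ) : ZMod N))).re : ℝ) : ℂ) =
        ∑ q ∈ Q, ZMod.stdAddChar (k * ((2 * (q.1 * d q.2) : ℤ) : ZMod N)) := by
      rw [hQ, Finset.sum_product_right]
      push_cast
      refine Finset.sum_congr rfl fun j _ => ?_
      rw [Finset.sum_pair (by norm_num)]
      have h2 : ZMod.stdAddChar (k * (2 * (((-1 : ℤ) : ZMod N) * (d j : ZMod N)))) =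
          (starRingEnd ℂ) (ZMod.stdAddChar (k * (2 * (d j : ZMod N)))) := by
        rw [← AddChar.map_neg_eq_conj]; congr 1; push_cast; ring
      rw [h2, Int.cast_one, one_mul, Complex.add_conj]; push_cast; ring
    rw [Complex.ofReal_pow, h1, ← Fin.prod_const, Finset.prod_univ_sum]
    refine Finset.sum_congr rfl fun p _ => ?_
    rw [← addChar_map_sum]
    congr 1
    push_cast
    rw [Finset.mul_sum, Finset.mul_sum]
  have hsum : ((∑ k : ZMod N, (∑ j ∈ J, 2 * (ZMod.stdAddChar (k * ((2 * d j : ℤ) : ZMod N))).re) ^ m : ℝ) : ℂ)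
      = N * #{p ∈ Fintype.piFinset fun _ : Fin m => Q | ∑ i, (p i).1 * d (p i).2 = 0} := by
    rw [Complex.ofReal_sum, Finset.sum_congr rfl fun k _ => hpt k, Finset.sum_comm,
      Finset.card_filter, Nat.cast_sum, Finset.mul_sum]
    refine Finset.sum_congr rfl fun p hp => ?_
    rw [AddChar.sum_mulShift _ (ZMod.isPrimitive_stdAddChar N), ZMod.card]
    by_cases h0 : ∑ i, (p i).1 * d (p i).2 = 0
    · rw [if_pos (by rw [h0]; simp), if_pos h0]; simp
    · rw [if_neg (zmod_intCast_ne_zero (mul_ne_zero two_ne_zero h0) _), if_neg h0]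
      · simp
      refine lt_of_le_of_lt ?_ hN
      rw [abs_mul, abs_two, mul_assoc]
      refine mul_le_mul_of_nonneg_left ((Finset.abs_sum_le_sum_abs _ _).trans ?_) (by norm_num)
      refine (Finset.sum_le_card_nsmul _ _ D fun i _ => ?_).trans (by simp)
      rw [abs_mul]
      have h3 := Finset.mem_product.1 (Fintype.mem_piFinset.1 hp i)
      have h4 : |(p i).1| = 1 := by
        have := h3.1
        simp only [Finset.mem_insert, Finset.mem_singleton] at this
        rcases this with h | h <;> simp [h]
      rw [h4, one_mul]; exact hD _
  have hreal : ∑ k : ZMod N, (∑ j ∈ J, 2 * (ZMod.stdAddChar (k * ((2 * d j : ℤ) : ZMod N))).re) ^ m =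
      N * (#{p ∈ Fintype.piFinset fun _ : Fin m => Q | ∑ i, (p i).1 * d (p i).2 = 0} : ℝ) := by
    exact_mod_cast hsum
  rw [hreal]
  gcongr
  refine Finset.card_le_card_of_injOn (fun p => (fun i => (p i).1, fun i => (p i).2)) ?_ ?_
  · intro p hp
    rw [Finset.mem_coe, Finset.mem_filter, Fintype.mem_piFinset] at hp
    simp only [Finset.coe_filter, Set.mem_ofPred_eq, Finset.mem_product, Finset.mem_univ, and_true,
      signCube, Fintype.mem_piFinset]
    exact ⟨fun i => (Finset.mem_product.1 (hp.1 i)).1, hp.2⟩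
  · intro p _ p' _ h
    simp only [Prod.mk.injEq] at h
    funext i
    exact Prod.ext (congrFun h.1 i) (congrFun h.2 i)

/-- Markov's inequality for the `2ℓ`-th moment of the cosine sum. -/
lemma card_energyBall_mul_pow_le {d : Fin n → ℤ} (J : Finset (Fin n)) (ℓ : ℕ) {D : ℤ}
    (hD : ∀ j, |d j| ≤ D) (hN : 2 * (2 * ℓ : ℕ) * D < N) {T : ℝ} (hT : T ^ 2 ≤ #J / 4) :
    (#(energyBall (N := N) d J T) : ℝ) * (#J : ℝ) ^ (2 * ℓ) ≤ N * signedZeroSums d (2 * ℓ) := by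
  refine le_trans ?_ (sum_cosine_pow_le J (2 * ℓ) hD hN)
  rw [← nsmul_eq_mul, ← Finset.sum_const]
  refine le_trans (Finset.sum_le_sum (g := fun k =>
      (∑ j ∈ J, 2 * (ZMod.stdAddChar (k * ((2 * d j : ℤ) : ZMod N))).re) ^ (2 * ℓ)) fun k hk => ?_)
      (Finset.sum_le_sum_of_subset_of_nonneg (Finset.subset_univ _) fun x _ _ => ?_)
  · have hk' : sineEnergy d J k ≤ T ^ 2 := by simpa [energyBall] using hk
    have h1 : ∑ j ∈ J, 2 * (ZMod.stdAddChar (k * ((2 * d j : ℤ) : ZMod N))).re =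
        2 * #J - 4 * sineEnergy d J k := by
      unfold sineEnergy
      rw [Finset.mul_sum, mul_comm (2 : ℝ), ← nsmul_eq_mul, ← Finset.sum_const,
        ← Finset.sum_sub_distrib]
      refine Finset.sum_congr rfl fun j _ => ?_
      have : k * ((2 * d j : ℤ) : ZMod N) = 2 * (k * (d j : ZMod N)) := by push_cast; ring
      rw [this, re_stdAddChar_two_mul]; ring
    rw [h1]
    gcongr
    linarith
  · rw [pow_mul]; positivity

lemma sum_succ_half_pow (M : ℕ) :
    ∑ i ∈ Finset.range M, ((i : ℝ) + 1) * (1 / 2) ^ i = 4 - (2 * M + 4) * (1 / 2) ^ M := by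
  induction M with
  | zero => norm_num
  | succ M ih => rw [Finset.sum_range_succ, ih, pow_succ]; push_cast; ring

/-- Layer-cake bound for the Laplace transform of the sine energy on a small-value set. -/
lemma sum_exp_energyBall_le (hN : N.Prime) (d : Fin n → ℤ) (J : Finset (Fin n)) {b T : ℝ}
    (hb : 0 < b) (hT : 0 < T) (hlt : #(energyBall (N := N) d J T) < N) :
    ∑ k ∈ energyBall (N := N) d J T, Real.exp (-(b * sineEnergy d J k)) ≤
      8 / (T * Real.sqrt b) * #(energyBall (N := N) d J T) + 2 := by
  classical
  set L := energyBall (N := N) d J T with hL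
  set M := ⌊b * T ^ 2⌋₊ + 1 with hM
  -- Cut at the integer levels of `b * sineEnergy` and use `exp (-i) ≤ 2 ^ (-i)`.
  have hpt : ∀ k ∈ L, Real.exp (-(b * sineEnergy d J k)) ≤ ∑ i ∈ Finset.range M,
      if b * sineEnergy d J k ≤ i + 1 then ((1 : ℝ) / 2) ^ i else 0 := by
    intro k hk
    have hk' : sineEnergy d J k ≤ T ^ 2 := by simpa [hL, energyBall] using hk
    have h0 : 0 ≤ b * sineEnergy d J k := mul_nonneg hb.le (sineEnergy_nonneg d J k)
    set i := ⌊b * sineEnergy d J k⌋₊ with hi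
    have hiM : i ∈ Finset.range M := by
      rw [Finset.mem_range, hM, Nat.lt_succ_iff]
      exact Nat.floor_le_floor (mul_le_mul_of_nonneg_left hk' hb.le)
    refine le_trans ?_ (Finset.single_le_sum (fun i _ => by split_ifs <;> positivity) hiM)
    rw [if_pos (Nat.lt_floor_add_one _).le]
    have h1 : Real.exp (-1) ≤ 1 / 2 := by
      rw [Real.exp_neg, one_div]
      exact inv_anti₀ (by norm_num) (by linarith [Real.add_one_le_exp (1 : ℝ)])
    calc Real.exp (-(b * sineEnergy d J k)) ≤ Real.exp (-(i : ℝ)) :=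
          Real.exp_le_exp.2 (neg_le_neg (Nat.floor_le h0))
      _ = Real.exp (-1) ^ i := by rw [← Real.exp_nat_mul]; congr 1; ring
      _ ≤ _ := by gcongr
  have hlevel : ∀ i : ℕ, (#{k ∈ L | b * sineEnergy d J k ≤ i + 1} : ℝ) ≤
      2 / (T * Real.sqrt b) * #L * (i + 1) + 1 := by
    intro i
    set τ := Real.sqrt ((i + 1) / b) with hτ
    have hτ0 : 0 < τ := Real.sqrt_pos.2 (by positivity)
    have hτle : τ ≤ (i + 1) / Real.sqrt b := by
      rw [hτ, Real.sqrt_div (by positivity)]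
      gcongr
      apply Real.sqrt_le_iff.2 ⟨by positivity, by nlinarith [Nat.cast_nonneg (α := ℝ) i]⟩
    have hτ2 : 2 * (τ / T) * #L + 1 ≤ 2 / (T * Real.sqrt b) * #L * (i + 1) + 1 := by
      calc 2 * (τ / T) * #L + 1 ≤ 2 * ((i + 1) / Real.sqrt b / T) * #L + 1 := by gcongr
        _ = _ := by field_simp
    refine le_trans ?_ hτ2
    rcases le_total τ T with h | h
    · refine le_trans ?_ (card_energyBall_le hN d J hτ0 h hlt)
      gcongr
      intro k hk
      rw [Finset.mem_filter] at hk
      simp only [energyBall, Finset.mem_filter, Finset.mem_univ, true_and]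
      rw [hτ, Real.sq_sqrt (by positivity), le_div_iff₀ hb]
      linarith [hk.2]
    · have h1 : (#{k ∈ L | b * sineEnergy d J k ≤ i + 1} : ℝ) ≤ #L := by
        exact_mod_cast Finset.card_filter_le _ _
      have h2 : 1 ≤ τ / T := (one_le_div hT).2 h
      have h3 : (0 : ℝ) ≤ #L := Nat.cast_nonneg _
      nlinarith
  calc ∑ k ∈ L, Real.exp (-(b * sineEnergy d J k))
      ≤ ∑ k ∈ L, ∑ i ∈ Finset.range M,
        if b * sineEnergy d J k ≤ i + 1 then ((1 : ℝ) / 2) ^ i else 0 := Finset.sum_le_sum hpt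
    _ = ∑ i ∈ Finset.range M, #{k ∈ L | b * sineEnergy d J k ≤ i + 1} * ((1 : ℝ) / 2) ^ i := by
        rw [Finset.sum_comm]
        refine Finset.sum_congr rfl fun i _ => ?_
        rw [← Finset.sum_filter, Finset.sum_const, nsmul_eq_mul]
    _ ≤ ∑ i ∈ Finset.range M, (2 / (T * Real.sqrt b) * #L * (i + 1) + 1) * ((1 : ℝ) / 2) ^ i := by
        gcongr with i _
        exact hlevel i
    _ = 2 / (T * Real.sqrt b) * #L * ∑ i ∈ Finset.range M, ((i : ℝ) + 1) * (1 / 2) ^ i +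
        ∑ i ∈ Finset.range M, ((1 : ℝ) / 2) ^ i := by
        rw [Finset.mul_sum, ← Finset.sum_add_distrib]
        exact Finset.sum_congr rfl fun i _ => by ring
    _ ≤ 2 / (T * Real.sqrt b) * #L * 4 + 2 := by
        gcongr
        · rw [sum_succ_half_pow]
          have : (0 : ℝ) ≤ (2 * M + 4) * (1 / 2) ^ M := by positivity
          linarith
        · exact sum_geometric_two_le M
    _ = _ := by ring

/-- A Halász-type inequality on `ZMod N`, for a large prime `N`. -/
theorem average_exp_sineEnergy_le (hN : N.Prime) {d : Fin n → ℤ} {J : Finset (Fin n)}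
    (hJ : J.Nonempty) (hd : ∀ j, d j ≠ 0) {D : ℤ} (hD : ∀ j, |d j| ≤ D) {ℓ : ℕ} (hℓ : 0 < ℓ)
    (hND : 2 * (2 * ℓ : ℕ) * D < N) {b : ℝ} (hb : 0 < b) :
    (∑ k : ZMod N, Real.exp (-(b * sineEnergy d J k))) / N ≤
      Real.exp (-(b * #J / 8)) + 24 / Real.sqrt (b * #J) *
        (signedZeroSums d (2 * ℓ) / (#J : ℝ) ^ (2 * ℓ)) + 2 / N := by
  classical
  have hN0 : (0 : ℝ) < N := by exact_mod_cast hN.pos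
  have hJ0 : (0 : ℝ) < #J := by exact_mod_cast hJ.card_pos
  set T := Real.sqrt (#J / 8) with hT
  have hT0 : 0 < T := Real.sqrt_pos.2 (by positivity)
  have hT2 : T ^ 2 = #J / 8 := Real.sq_sqrt (by positivity)
  have hN2 : ∀ j, |2 * d j| < N := by
    intro j
    have h1 := hD j
    have h2 : 0 ≤ D := (abs_nonneg _).trans h1
    rw [abs_mul, abs_two]
    have h3 : (1 : ℤ) ≤ (2 * ℓ : ℕ) := by omega
    nlinarith
  have hlt := card_energyBall_lt (N := N) (J := J) hd hN2 (T := T) (by rw [hT2]; linarith)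
  have hlow := sum_exp_energyBall_le hN d J hb hT0 hlt
  have hmom := card_energyBall_mul_pow_le (N := N) J ℓ hD hND (T := T) (by rw [hT2]; linarith)
  set L := energyBall (N := N) d J T with hL
  have hhigh : ∑ k ∈ Lᶜ, Real.exp (-(b * sineEnergy d J k)) ≤ N * Real.exp (-(b * #J / 8)) := by
    refine (Finset.sum_le_card_nsmul _ _ (Real.exp (-(b * #J / 8))) fun k hk => ?_).trans ?_
    · rw [Finset.mem_compl, hL, energyBall, Finset.mem_filter, not_and, not_le] at hk
      have := hk (Finset.mem_univ _)
      rw [hT2] at this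
      apply Real.exp_le_exp.2
      nlinarith
    · rw [nsmul_eq_mul]
      gcongr
      simpa [ZMod.card] using Finset.card_le_univ Lᶜ
  have hconst : 8 / (T * Real.sqrt b) ≤ 24 / Real.sqrt (b * #J) := by
    rw [div_le_div_iff₀ (by positivity) (by positivity), Real.sqrt_mul hb.le]
    have : Real.sqrt #J ≤ 3 * T := by
      apply Real.sqrt_le_iff.2 ⟨by positivity, ?_⟩
      rw [mul_pow, hT2]; linarith
    nlinarith [Real.sqrt_nonneg b]
  have hLN : (#L : ℝ) ≤ N * (signedZeroSums d (2 * ℓ) / (#J : ℝ) ^ (2 * ℓ)) := by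
    rw [← mul_div_assoc, le_div_iff₀ (by positivity)]; exact hmom
  rw [← Finset.sum_add_sum_compl L, div_le_iff₀ hN0]
  calc _ ≤ (8 / (T * Real.sqrt b) * #L + 2) + N * Real.exp (-(b * #J / 8)) := add_le_add hlow hhigh
    _ ≤ (24 / Real.sqrt (b * #J) * (N * (signedZeroSums d (2 * ℓ) / (#J : ℝ) ^ (2 * ℓ))) + 2) +
        N * Real.exp (-(b * #J / 8)) := by gcongr
    _ = _ := by field_simp; ring

end Halasz

/-! ### Averaging over the frequency -/

lemma mean_rpow_le_mean {ι : Type*} {s : Finset ι} (hs : s.Nonempty) {z : ι → ℝ}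
    (hz : ∀ i ∈ s, 0 ≤ z i) {ν : ℝ} (hν : 0 < ν) :
    ((∑ i ∈ s, z i) / #s) ^ (1 + ν) ≤ (∑ i ∈ s, z i ^ (1 + ν)) / #s := by
  have hc : (#s : ℝ) ≠ 0 := by exact_mod_cast hs.card_pos.ne'
  have h := Real.rpow_arith_mean_le_arith_mean_rpow s (fun _ => (#s : ℝ)⁻¹) z
    (fun _ _ => by positivity) (by rw [Finset.sum_const, nsmul_eq_mul, mul_inv_cancel₀ hc]) hz
    (p := 1 + ν) (by linarith)
  rwa [← Finset.mul_sum, ← Finset.mul_sum, inv_mul_eq_div, inv_mul_eq_div] at h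

lemma mean_rpow_inv_le {ι : Type*} {s : Finset ι} (hs : s.Nonempty) {z : ι → ℝ}
    (hz : ∀ i ∈ s, 0 ≤ z i) {ν : ℝ} (hν : 0 < ν) :
    (∑ i ∈ s, z i ^ (1 / (1 + ν))) / #s ≤ ((∑ i ∈ s, z i) / #s) ^ (1 / (1 + ν)) := by
  have hν' : (0 : ℝ) < 1 + ν := by linarith
  have h := mean_rpow_le_mean hs (z := fun i => z i ^ (1 / (1 + ν)))
    (fun i hi => Real.rpow_nonneg (hz i hi) _) hν
  have e : ∀ i ∈ s, (z i ^ (1 / (1 + ν))) ^ (1 + ν) = z i := fun i hi => by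
    rw [← Real.rpow_mul (hz i hi), one_div_mul_cancel hν'.ne', Real.rpow_one]
  rw [Finset.sum_congr rfl e] at h
  have h0 : 0 ≤ (∑ i ∈ s, z i ^ (1 / (1 + ν))) / #s :=
    div_nonneg (Finset.sum_nonneg fun i hi => Real.rpow_nonneg (hz i hi) _) (Nat.cast_nonneg _)
  have h1 := Real.rpow_le_rpow (Real.rpow_nonneg h0 _) h (z := 1 / (1 + ν)) (by positivity)
  rwa [← Real.rpow_mul h0, mul_one_div_cancel hν'.ne', Real.rpow_one] at h1

/-- The indicator function of a subset of the cube. -/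
noncomputable def indic {n : ℕ} (S : Finset (Fin n → Bool)) (x : Fin n → Bool) : ℝ :=
  if x ∈ S then 1 else 0

lemma indic_nonneg {n : ℕ} (S : Finset (Fin n → Bool)) (x : Fin n → Bool) : 0 ≤ indic S x := by
  unfold indic; split_ifs <;> norm_num

lemma sum_indic_mul {n : ℕ} (S : Finset (Fin n → Bool)) (F : (Fin n → Bool) → ℝ) :
    ∑ x, indic S x * F x = ∑ x ∈ S, F x := by
  simp [indic, Finset.sum_ite_mem]

lemma sum_indic {n : ℕ} (S : Finset (Fin n → Bool)) : ∑ x, indic S x = #S := by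
  simpa using sum_indic_mul S fun _ => 1

/-- For sets: the mean over `S` of the `(1+ν)`-th power of the normalized sum is at most the
`1/(1+ν)`-th power of the mean over `S × T` of `exp (-decay)`. -/
lemma mean_signSum_rpow_le {κ ν : ℝ} (hκ : 0 < κ) (hκ1 : κ ≤ 1) (hν : 0 < ν) (hν1 : ν ≤ 1) {n : ℕ}
    (α : Fin n → Bool → ℝ) {S T : Finset (Fin n → Bool)} (hS : S.Nonempty) (hT : T.Nonempty) :
    (∑ x ∈ S, (‖signSum α (indic T) x‖ / #T) ^ (1 + ν)) / #S ≤
      ((∑ y ∈ T, (∑ x ∈ S, Real.exp (-decay κ ν α (LateBranch κ (indic S) x)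
        (EarlyBranch κ (indic T) y))) / #S) / #T) ^ (1 / (1 + ν)) := by
  have hν' : (0 : ℝ) < 1 + ν := by linarith
  have hS0 : (0 : ℝ) < #S := by exact_mod_cast hS.card_pos
  have hT0 : (0 : ℝ) < #T := by exact_mod_cast hT.card_pos
  have h := sum_signSum_rpow_le hκ hκ1 hν hν1 α (indic S) (fun _ => 1) (indic T) (indic_nonneg S)
    (fun _ => zero_le_one) (indic_nonneg T)
  simp only [Real.one_rpow, mul_one, sum_indic_mul, sum_indic] at h
  set E : (Fin n → Bool) → ℝ := fun y => ∑ x ∈ S, Real.exp (-decay κ ν α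
    (LateBranch κ (indic S) x) (EarlyBranch κ (indic T) y)) with hE
  have hE0 : ∀ y, 0 ≤ E y := fun y => Finset.sum_nonneg fun x _ => (Real.exp_pos _).le
  refine le_trans ?_ (mean_rpow_inv_le hT (fun y _ => div_nonneg (hE0 y) hS0.le) hν)
  have e1 : ∑ x ∈ S, (‖signSum α (indic T) x‖ / #T) ^ (1 + ν) =
      (∑ x ∈ S, ‖signSum α (indic T) x‖ ^ (1 + ν)) / (#T : ℝ) ^ (1 + ν) := by
    rw [Finset.sum_div]
    exact Finset.sum_congr rfl fun x _ => Real.div_rpow (norm_nonneg _) hT0.le _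
  have e2 : ∀ y, (E y / #S) ^ (1 / (1 + ν)) =
      (#S : ℝ) ^ (ν / (1 + ν)) * E y ^ (1 / (1 + ν)) / #S := by
    intro y
    rw [Real.div_rpow (hE0 y) hS0.le, div_eq_div_iff (by positivity) hS0.ne']
    have : (#S : ℝ) = (#S : ℝ) ^ (ν / (1 + ν)) * (#S : ℝ) ^ (1 / (1 + ν)) := by
      rw [← Real.rpow_add hS0]
      have : ν / (1 + ν) + 1 / (1 + ν) = 1 := by field_simp; ring
      rw [this, Real.rpow_one]
    nth_rewrite 1 [this]; ring
  rw [e1, Finset.sum_congr rfl fun y _ => e2 y, ← Finset.sum_div, div_div, div_div]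
  rw [div_le_div_iff₀ (by positivity) (by positivity)]
  rw [Real.rpow_add hT0, Real.rpow_one]
  calc _ ≤ ((#T : ℝ) ^ ν * ∑ y ∈ T, (#S : ℝ) ^ (ν / (1 + ν)) * E y ^ (1 / (1 + ν))) * (#S * #T) :=
        mul_le_mul_of_nonneg_right h (by positivity)
    _ = _ := by ring

lemma mean_mean_signSum_rpow_le {κ ν : ℝ} (hκ : 0 < κ) (hκ1 : κ ≤ 1) (hν : 0 < ν) (hν1 : ν ≤ 1)
    {n : ℕ} {K : Type*} [Fintype K] [Nonempty K] (α : K → Fin n → Bool → ℝ)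
    {S T : Finset (Fin n → Bool)} (hS : S.Nonempty) (hT : T.Nonempty) :
    ((∑ k, (∑ x ∈ S, ‖signSum (α k) (indic T) x‖ / #T) / #S) / Fintype.card K) ^ ((1 + ν) ^ 2) ≤
      (∑ y ∈ T, ∑ x ∈ S, (∑ k, Real.exp (-decay κ ν (α k) (LateBranch κ (indic S) x)
        (EarlyBranch κ (indic T) y))) / Fintype.card K) / (#S * #T) := by
  have hν' : (0 : ℝ) < 1 + ν := by linarith
  set E : K → ℝ := fun k => (∑ y ∈ T, (∑ x ∈ S, Real.exp (-decay κ ν (α k)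
    (LateBranch κ (indic S) x) (EarlyBranch κ (indic T) y))) / #S) / #T with hE
  have hE0 : ∀ k, 0 ≤ E k := fun k => by
    have : ∀ y, 0 ≤ ∑ x ∈ S, Real.exp (-decay κ ν (α k)
      (LateBranch κ (indic S) x) (EarlyBranch κ (indic T) y)) := fun y =>
        Finset.sum_nonneg fun x _ => (Real.exp_pos _).le
    exact div_nonneg (Finset.sum_nonneg fun y _ => div_nonneg (this y) (Nat.cast_nonneg _))
      (Nat.cast_nonneg _)
  set m : K → ℝ := fun k => (∑ x ∈ S, ‖signSum (α k) (indic T) x‖ / #T) / #S with hm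
  have hm0 : ∀ k, 0 ≤ m k := fun k =>
    div_nonneg (Finset.sum_nonneg fun x _ => div_nonneg (norm_nonneg _) (Nat.cast_nonneg _))
      (Nat.cast_nonneg _)
  have h1 : ∀ k, m k ^ (1 + ν) ≤ E k ^ (1 / (1 + ν)) := fun k =>
    (mean_rpow_le_mean hS (fun x _ => div_nonneg (norm_nonneg _) (Nat.cast_nonneg _)) hν).trans
      (mean_signSum_rpow_le hκ hκ1 hν hν1 (α k) hS hT)
  have hK : (Finset.univ : Finset K).Nonempty := Finset.univ_nonempty
  have h2 : ((∑ k, m k) / Fintype.card K) ^ (1 + ν) ≤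
      ((∑ k, E k) / Fintype.card K) ^ (1 / (1 + ν)) := by
    refine (mean_rpow_le_mean hK (fun k _ => hm0 k) hν).trans ?_
    refine le_trans ?_ (mean_rpow_inv_le hK (fun k _ => hE0 k) hν)
    gcongr with k
    exact h1 k
  have hM0 : 0 ≤ (∑ k, m k) / Fintype.card K :=
    div_nonneg (Finset.sum_nonneg fun k _ => hm0 k) (Nat.cast_nonneg _)
  have hEs0 : 0 ≤ (∑ k, E k) / Fintype.card K :=
    div_nonneg (Finset.sum_nonneg fun k _ => hE0 k) (Nat.cast_nonneg _)
  have h3 := Real.rpow_le_rpow (Real.rpow_nonneg hM0 _) h2 hν'.le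
  rw [← Real.rpow_mul hM0, ← Real.rpow_mul hEs0, one_div_mul_cancel hν'.ne', Real.rpow_one,
    ← sq] at h3
  refine h3.trans (le_of_eq ?_)
  simp only [hE, Finset.sum_div]
  rw [Finset.sum_comm]
  refine Finset.sum_congr rfl fun y _ => ?_
  rw [Finset.sum_comm]
  refine Finset.sum_congr rfl fun x _ => Finset.sum_congr rfl fun k _ => ?_
  rw [div_div, div_div, div_div]; ring

open MeasureTheory Filter Topology in
lemma tendsto_riemann_sum {f : ℝ → ℝ} (hf : Continuous f) :
    Tendsto (fun N : ℕ => (∑ k ∈ Finset.range N, f (k / N)) / N) atTop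
      (𝓝 (∫ θ in (0 : ℝ)..1, f θ)) := by
  rw [Metric.tendsto_atTop]
  intro ε hε
  have huc := isCompact_Icc.uniformContinuousOn_of_continuous (s := Set.Icc (0 : ℝ) 1)
    hf.continuousOn
  obtain ⟨η, hη, hclose⟩ := Metric.uniformContinuousOn_iff.1 huc (ε / 2) (by positivity)
  obtain ⟨N₀, hN₀⟩ := exists_nat_gt (1 / η)
  refine ⟨N₀ + 1, fun N hN => ?_⟩
  have hNpos : (0 : ℝ) < N := by exact_mod_cast (by omega : 0 < N)
  have hNη : 1 / (N : ℝ) < η := by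
    have : 1 / η < N := hN₀.trans_le (by exact_mod_cast (by omega : N₀ ≤ N))
    rw [div_lt_iff₀ hη] at this
    rw [div_lt_iff₀ hNpos]; linarith
  have hsplit : ∫ θ in (0 : ℝ)..1, f θ =
      ∑ k ∈ Finset.range N, ∫ θ in ((k : ℕ) / N : ℝ)..((k + 1 : ℕ) / N : ℝ), f θ := by
    rw [intervalIntegral.sum_integral_adjacent_intervals (a := fun k : ℕ => (k / N : ℝ))
      fun k _ => hf.intervalIntegrable _ _]
    simp [hNpos.ne']
  have hpiece : ∀ k ∈ Finset.range N,
      ‖f (k / N) / N - ∫ θ in ((k : ℕ) / N : ℝ)..((k + 1 : ℕ) / N : ℝ), f θ‖ ≤ ε / 2 / N := by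
    intro k hk
    have hlen : ((k + 1 : ℕ) / N : ℝ) - (k : ℕ) / N = 1 / N := by push_cast; ring
    have hkN : ((k + 1 : ℕ) : ℝ) ≤ N := by
      exact_mod_cast Nat.succ_le_of_lt (Finset.mem_range.1 hk)
    have hle : ((k : ℕ) / N : ℝ) ≤ (k + 1 : ℕ) / N := by
      have : (0 : ℝ) < 1 / N := by positivity
      linarith
    have h1 : f (k / N) / N = ∫ _θ in ((k : ℕ) / N : ℝ)..((k + 1 : ℕ) / N : ℝ), f (k / N) := by
      rw [intervalIntegral.integral_const, hlen, smul_eq_mul]; ring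
    rw [h1, ← intervalIntegral.integral_sub (by simp) (hf.intervalIntegrable _ _)]
    refine (intervalIntegral.norm_integral_le_of_norm_le_const (C := ε / 2) fun θ hθ => ?_).trans
      (le_of_eq ?_)
    · rw [Set.uIoc_of_le hle] at hθ
      have hk0 : (0 : ℝ) ≤ k / N := by positivity
      have hk1 : ((k + 1 : ℕ) / N : ℝ) ≤ 1 := (div_le_one hNpos).2 hkN
      have := hclose (k / N) ⟨hk0, hle.trans hk1⟩ θ ⟨hk0.trans hθ.1.le, hθ.2.trans hk1⟩ (by
        rw [Real.dist_eq, abs_sub_comm, abs_of_pos (by linarith [hθ.1])]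
        linarith [hθ.2])
      rw [Real.dist_eq] at this
      exact this.le
    · rw [hlen, abs_of_pos (by positivity)]; ring
  rw [Real.dist_eq, hsplit, Finset.sum_div, ← Finset.sum_sub_distrib, ← Real.norm_eq_abs]
  calc _ ≤ ∑ k ∈ Finset.range N, ε / 2 / N := norm_sum_le_of_le _ hpiece
    _ = ε / 2 := by rw [Finset.sum_const, Finset.card_range, nsmul_eq_mul]; field_simp
    _ < ε := by linarith

/-! ### Two-cubes as Boolean cubes -/

/-- The point of the two-cube `A` encoded by `s`, with `true` standing for `uⱼ`. -/
def TwoCube.ofBool {n : ℕ} (A : TwoCube n) (s : Fin n → Bool) (j : Fin n) : ℤ :=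
  if s j then A.u j else A.v j

lemma TwoCube.ofBool_injective {n : ℕ} (A : TwoCube n) : Function.Injective A.ofBool := by
  intro s t h
  funext j
  have := congrFun h j
  have hne := A.ne j
  unfold TwoCube.ofBool at this
  cases hs : s j <;> cases ht : t j <;> simp_all

lemma TwoCube.exists_ofBool {n : ℕ} (A : TwoCube n) {x : Fin n → ℤ} (hx : x ∈ A.points) :
    ∃ s, A.ofBool s = x := by
  classical
  refine ⟨fun j => decide (x j = A.u j), funext fun j => ?_⟩
  have h := Fintype.mem_piFinset.1 hx j
  simp only [Finset.mem_insert, Finset.mem_singleton] at h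
  unfold TwoCube.ofBool
  by_cases hj : x j = A.u j
  · simp [hj]
  · rw [if_neg (by simpa using hj)]
    exact (h.resolve_left hj).symm

/-- The two-cube with all coordinates in `{1, -1}`. -/
def signTwoCube (n : ℕ) : TwoCube n := ⟨fun _ => 1, fun _ => -1, fun _ => by norm_num⟩

lemma signTwoCube_points (n : ℕ) : (signTwoCube n).points = signCube n := rfl

lemma signTwoCube_ofBool {n : ℕ} (t : Fin n → Bool) (j : Fin n) :
    ((signTwoCube n).ofBool t j : ℝ) = boolSign (t j) := by
  unfold TwoCube.ofBool signTwoCube boolSign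
  split_ifs <;> simp

open Classical in
/-- The Boolean codes of the points of `S` in the two-cube `A`. -/
noncomputable def TwoCube.code {n : ℕ} (A : TwoCube n) (S : Finset (Fin n → ℤ)) :
    Finset (Fin n → Bool) := {s | A.ofBool s ∈ S}

lemma TwoCube.sum_code {n : ℕ} {M : Type*} [AddCommMonoid M] (A : TwoCube n)
    {S : Finset (Fin n → ℤ)} (hS : S ⊆ A.points) (F : (Fin n → ℤ) → M) :
    ∑ s ∈ A.code S, F (A.ofBool s) = ∑ x ∈ S, F x := by
  refine Finset.sum_nbij A.ofBool (fun s hs => by simpa [TwoCube.code] using hs)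
    A.ofBool_injective.injOn (fun x hx => ?_) fun _ _ => rfl
  obtain ⟨s, rfl⟩ := A.exists_ofBool (hS hx)
  exact ⟨s, by simpa [TwoCube.code] using hx, rfl⟩

lemma TwoCube.card_code {n : ℕ} (A : TwoCube n) {S : Finset (Fin n → ℤ)} (hS : S ⊆ A.points) :
    #(A.code S) = #S := by
  rw [Finset.card_eq_sum_ones, Finset.card_eq_sum_ones]
  exact A.sum_code hS fun _ => 1

/-- The phases `2πθ a` for `a` in the `j`-th factor of the two-cube. -/
noncomputable def TwoCube.angle {n : ℕ} (A : TwoCube n) (θ : ℝ) (j : Fin n) (a : Bool) : ℝ :=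
  2 * Real.pi * θ * (if a then A.u j else A.v j : ℤ)

lemma norm_charAvg_ofBool {n : ℕ} (A : TwoCube n) {B : Finset (Fin n → ℤ)} (hB : B ⊆ signCube n)
    (s : Fin n → Bool) (θ : ℝ) :
    ‖charAvg B (A.ofBool s) θ‖ = ‖signSum (A.angle θ) (indic ((signTwoCube n).code B)) s‖ /
      #((signTwoCube n).code B) := by
  unfold charAvg
  have hsum := (signTwoCube n).sum_code (S := B) hB fun y =>
    Complex.exp (2 * (Real.pi : ℂ) * Complex.I * (θ : ℂ) * ((∑ j, A.ofBool s j * y j : ℤ) : ℂ))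
  rw [norm_div, Complex.norm_natCast, (signTwoCube n).card_code hB, ← hsum]
  congr 2
  unfold signSum
  have h : ∀ y, (indic ((signTwoCube n).code B) y : ℂ) *
      Complex.exp ((∑ j, A.angle θ j (s j) * boolSign (y j) : ℝ) * Complex.I) =
      if y ∈ (signTwoCube n).code B then
        Complex.exp ((∑ j, A.angle θ j (s j) * boolSign (y j) : ℝ) * Complex.I) else 0 := by
    intro y; unfold indic; split_ifs <;> simp
  simp only [h, Finset.sum_ite_mem, Finset.univ_inter]
  refine Finset.sum_congr rfl fun y _ => ?_
  congr 1
  have h2 : (((∑ j, A.ofBool s j * (signTwoCube n).ofBool y j : ℤ) : ℝ)) * (2 * Real.pi * θ) =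
      ∑ j, A.angle θ j (s j) * boolSign (y j) := by
    push_cast
    rw [Finset.sum_mul]
    refine Finset.sum_congr rfl fun j _ => ?_
    rw [signTwoCube_ofBool, TwoCube.angle, TwoCube.ofBool]; ring
  rw [← h2]; push_cast; ring

lemma sin_angle_sub_sq {n N : ℕ} [NeZero N] (A : TwoCube n) (k : ZMod N) (j : Fin n) :
    Real.sin (A.angle (k.val / N) j true - A.angle (k.val / N) j false) ^ 2 =
      (ZMod.stdAddChar (k * (A.diff j : ZMod N))).im ^ 2 := by
  have h : k * (A.diff j : ZMod N) = (((k.val : ℤ) * A.diff j : ℤ) : ZMod N) := by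
    push_cast; rw [ZMod.natCast_val, ZMod.cast_id', id]
  have e : 2 * (Real.pi : ℂ) * Complex.I * (((k.val : ℤ) * A.diff j : ℤ) : ℂ) / (N : ℂ) =
      ((A.angle (k.val / N) j true - A.angle (k.val / N) j false : ℝ) : ℂ) * Complex.I := by
    simp only [TwoCube.angle, TwoCube.diff, if_true, Bool.false_eq_true, if_false]
    push_cast; ring
  rw [h, ZMod.stdAddChar_coe, e, Complex.exp_ofReal_mul_I_im]

open Classical in
lemma decay_angle_eq {n N : ℕ} [NeZero N] (A : TwoCube n) (κ ν : ℝ) (I J : Fin n → Prop)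
    (k : ZMod N) :
    decay κ ν (A.angle (k.val / N)) I J =
      ν * κ ^ 2 / 32 * sineEnergy A.diff {j | I j ∧ J j} k := by
  unfold decay sineEnergy
  rw [Finset.mul_sum, Finset.sum_filter]
  refine Finset.sum_congr rfl fun j _ => ?_
  split_ifs
  · rw [sin_angle_sub_sq]; ring
  · rfl

/-! ### Sets of large product -/

open Classical in
lemma average_exp_decay_le {n N : ℕ} [NeZero N] (hN : N.Prime) (A : TwoCube n) {κ ν τ : ℝ}
    (hκ : 0 < κ) (hν : 0 < ν) (hτ : 0 < τ) {I J : Fin n → Prop} (hIJ : τ ≤ #{j | I j ∧ J j})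
    {D : ℤ} (hD : ∀ j, |A.diff j| ≤ D) {ℓ : ℕ} (hℓ : 0 < ℓ) (hND : 2 * (2 * ℓ : ℕ) * D < N) :
    (∑ k : ZMod N, Real.exp (-decay κ ν (A.angle (k.val / N)) I J)) / N ≤
      Real.exp (-(ν * κ ^ 2 / 32 * τ / 8)) +
        24 / Real.sqrt (ν * κ ^ 2 / 32 * τ) * (A.r ℓ / τ ^ (2 * ℓ)) + 2 / N := by
  have hb : 0 < ν * κ ^ 2 / 32 := by positivity
  have hne : ({j | I j ∧ J j} : Finset (Fin n)).Nonempty := by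
    rw [← Finset.card_pos]; exact_mod_cast hτ.trans_le hIJ
  have hdiff : ∀ j, A.diff j ≠ 0 := fun j => sub_ne_zero.2 (A.ne j)
  simp only [decay_angle_eq]
  refine (average_exp_sineEnergy_le hN hne hdiff hD hℓ hND hb).trans ?_
  have hr : signedZeroSums A.diff (2 * ℓ) = A.r ℓ := rfl
  rw [hr]
  gcongr

open Classical in
/-- If `|S| ≥ 2^{(1-β+δ)n}` and `|T| ≥ 2^{βn}`, then apart from an exponentially small fraction of
the pairs in `S × T`, at least `δ n / 2` coordinates branch for both members. -/
lemma sum_pairs_le {n : ℕ} {κ β δ Q : ℝ} (hκ : 0 < κ)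
    (hκδ : 1 + Real.sqrt κ ≤ (2 : ℝ) ^ (δ / 4 / 4)) {S T : Finset (Fin n → Bool)}
    (hS : (2 : ℝ) ^ ((1 - β + δ) * n) ≤ #S) (hT : (2 : ℝ) ^ (β * n) ≤ #T)
    (f : (Fin n → Bool) → (Fin n → Bool) → ℝ) (hQ : 0 ≤ Q) (hf : ∀ x y, f x y ≤ 1)
    (hfQ : ∀ x y, δ / 2 * n ≤ #{j | LateBranch κ (indic S) x j ∧ EarlyBranch κ (indic T) y j} →
      f x y ≤ Q) :
    ∑ y ∈ T, ∑ x ∈ S, f x y ≤ (Q + 2 * (2 : ℝ) ^ (-(δ / 4 * n / 4))) * (#S * #T) := by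
  set cS : (Fin n → Bool) → ℕ := fun x => #{j | LateBranch κ (indic S) x j} with hcS
  set cT : (Fin n → Bool) → ℕ := fun y => #{j | EarlyBranch κ (indic T) y j} with hcT
  have hS' := card_few_le (S := S) (c := cS) hκδ hS
    (sum_sqrt_lateBranch_le hκ.le (indic S) (indic_nonneg S))
  have hT' := card_few_le (S := T) (c := cT) hκδ hT
    (sum_sqrt_earlyBranch_le hκ.le (indic T) (indic_nonneg T))
  set pS : (Fin n → Bool) → ℝ := fun x => if (cS x : ℝ) < (1 - β + δ - δ / 4) * n then 1 else 0
    with hpS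
  set pT : (Fin n → Bool) → ℝ := fun y => if (cT y : ℝ) < (β - δ / 4) * n then 1 else 0 with hpT
  have hpS0 : ∀ x, 0 ≤ pS x := fun x => by simp only [hpS]; split_ifs <;> norm_num
  have hpT0 : ∀ x, 0 ≤ pT x := fun x => by simp only [hpT]; split_ifs <;> norm_num
  have hpt : ∀ x y, f x y ≤ Q + pS x + pT y := by
    intro x y
    by_cases hx : (cS x : ℝ) < (1 - β + δ - δ / 4) * n
    · have : pS x = 1 := if_pos hx
      linarith [hf x y, hpT0 y]
    by_cases hy : (cT y : ℝ) < (β - δ / 4) * n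
    · have : pT y = 1 := if_pos hy
      linarith [hf x y, hpS0 x]
    have h1 : f x y ≤ Q := by
      apply hfQ
      have h2 := Finset.card_union_add_card_inter
        (Finset.univ.filter fun j => LateBranch κ (indic S) x j)
        (Finset.univ.filter fun j => EarlyBranch κ (indic T) y j)
      rw [← Finset.filter_and] at h2
      have h3 : #((Finset.univ.filter fun j => LateBranch κ (indic S) x j) ∪
          (Finset.univ.filter fun j => EarlyBranch κ (indic T) y j)) ≤ n := by
        simpa using Finset.card_le_univ ((Finset.univ.filter fun j => LateBranch κ (indic S) x j) ∪
          (Finset.univ.filter fun j => EarlyBranch κ (indic T) y j))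
      have h4 : cS x + cT y ≤
          n + #{j | LateBranch κ (indic S) x j ∧ EarlyBranch κ (indic T) y j} := by
        simp only [hcS, hcT]; omega
      have h5 : (cS x : ℝ) + cT y ≤
          n + #{j | LateBranch κ (indic S) x j ∧ EarlyBranch κ (indic T) y j} := by
        exact_mod_cast h4
      push Not at hx hy
      linarith
    linarith [hpS0 x, hpT0 y]
  have hsS : ∑ x ∈ S, pS x = #{x ∈ S | (cS x : ℝ) < (1 - β + δ - δ / 4) * n} := by
    simp [hpS]
  have hsT : ∑ y ∈ T, pT y = #{y ∈ T | (cT y : ℝ) < (β - δ / 4) * n} := by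
    simp [hpT]
  rw [← hsS] at hS'
  rw [← hsT] at hT'
  calc ∑ y ∈ T, ∑ x ∈ S, f x y ≤ ∑ y ∈ T, ∑ x ∈ S, (Q + pS x + pT y) :=
        Finset.sum_le_sum fun y _ => Finset.sum_le_sum fun x _ => hpt x y
    _ = Q * (#S * #T) + (∑ x ∈ S, pS x) * #T + #S * ∑ y ∈ T, pT y := by
        simp only [Finset.sum_add_distrib, Finset.sum_const, nsmul_eq_mul, ← Finset.mul_sum]
        ring
    _ ≤ Q * (#S * #T) + ((2 : ℝ) ^ (-(δ / 4 * n / 4)) * #S) * #T +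
        #S * ((2 : ℝ) ^ (-(δ / 4 * n / 4)) * #T) := by gcongr
    _ = _ := by ring

/-- The discrete form of the main estimate, with `θ` uniform in the multiples of `1 / N`. -/
lemma discrete_mean_rpow_le {n N : ℕ} [NeZero N] (hN : N.Prime) (hn : 0 < n) (A : TwoCube n)
    {κ ν β δ : ℝ} (hκ : 0 < κ) (hκ1 : κ ≤ 1) (hν : 0 < ν) (hν1 : ν ≤ 1) (hδ : 0 < δ)
    (hκδ : 1 + Real.sqrt κ ≤ (2 : ℝ) ^ (δ / 4 / 4)) {S B : Finset (Fin n → ℤ)}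
    (hSA : S ⊆ A.points) (hB : B ⊆ signCube n)
    (hS : (2 : ℝ) ^ ((1 - β + δ) * n) ≤ #S) (hT : (2 : ℝ) ^ (β * n) ≤ #B)
    {D : ℤ} (hD : ∀ j, |A.diff j| ≤ D) {ℓ : ℕ} (hℓ : 0 < ℓ) (hND : 2 * (2 * ℓ : ℕ) * D < N) :
    ((∑ k ∈ Finset.range N, (∑ x ∈ S, ‖charAvg B x (k / N)‖) / #S) / N) ^ ((1 + ν) ^ 2) ≤
      Real.exp (-(ν * κ ^ 2 / 32 * (δ / 2 * n) / 8)) +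
        24 / Real.sqrt (ν * κ ^ 2 / 32 * (δ / 2 * n)) * (A.r ℓ / (δ / 2 * n) ^ (2 * ℓ)) + 2 / N +
        2 * (2 : ℝ) ^ (-(δ / 4 * n / 4)) := by
  have hB' : B ⊆ (signTwoCube n).points := by rw [signTwoCube_points]; exact hB
  set S' := A.code S with hS'
  set T := (signTwoCube n).code B with hT'
  have hcS : #S' = #S := A.card_code hSA
  have hcT : #T = #B := (signTwoCube n).card_code hB'
  rw [← hcS] at hS ⊢
  rw [← hcT] at hT
  have hS0 : (0 : ℝ) < #S' := lt_of_lt_of_le (by positivity) hS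
  have hT0 : (0 : ℝ) < #T := lt_of_lt_of_le (by positivity) hT
  have hSn : S'.Nonempty := Finset.card_pos.1 (by exact_mod_cast hS0)
  have hTn : T.Nonempty := Finset.card_pos.1 (by exact_mod_cast hT0)
  have hrange : ∀ F : ℝ → ℝ, ∑ k ∈ Finset.range N, F (k / N) = ∑ k : ZMod N, F (k.val / N) := by
    intro F
    refine (Finset.sum_nbij (fun k : ZMod N => k.val)
      (fun k _ => Finset.mem_range.2 (ZMod.val_lt k)) (ZMod.val_injective N).injOn
      (fun k hk => ⟨(k : ZMod N), Finset.mem_coe.2 (Finset.mem_univ _),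
        ZMod.val_cast_of_lt (Finset.mem_range.1 hk)⟩) fun _ _ => rfl).symm
  rw [hrange fun θ => (∑ x ∈ S, ‖charAvg B x θ‖) / #S']
  have hcode : ∀ θ, ∑ x ∈ S, ‖charAvg B x θ‖ =
      ∑ s ∈ S', ‖signSum (A.angle θ) (indic T) s‖ / #T := by
    intro θ
    rw [← A.sum_code hSA]
    exact Finset.sum_congr rfl fun s _ => norm_charAvg_ofBool A hB s θ
  simp only [hcode]
  have hmain := mean_mean_signSum_rpow_le hκ hκ1 hν hν1
    (fun k : ZMod N => A.angle (k.val / N)) hSn hTn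
  rw [ZMod.card] at hmain
  refine hmain.trans ?_
  rw [div_le_iff₀ (by positivity)]
  have hn0 : (0 : ℝ) < n := by exact_mod_cast hn
  refine sum_pairs_le hκ hκδ hS hT (fun x y => (∑ k : ZMod N, Real.exp (-decay κ ν
    (A.angle (k.val / N)) (LateBranch κ (indic S') x) (EarlyBranch κ (indic T) y))) / N)
    (by positivity) (fun x y => ?_) fun x y hxy => ?_
  · have hN0 : (0 : ℝ) < N := by exact_mod_cast hN.pos
    rw [div_le_one hN0]
    refine (Finset.sum_le_card_nsmul _ _ 1 fun k _ => ?_).trans (by simp [ZMod.card])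
    rw [Real.exp_le_one_iff, neg_nonpos]
    refine Finset.sum_nonneg fun j _ => ?_
    split_ifs <;> positivity
  · exact average_exp_decay_le hN A hκ hν (by positivity) hxy hD hℓ hND

lemma continuous_norm_charAvg {n : ℕ} (B : Finset (Fin n → ℤ)) (x : Fin n → ℤ) :
    Continuous fun θ : ℝ => ‖charAvg B x θ‖ := by
  unfold charAvg
  fun_prop

lemma norm_charAvg_le_one {n : ℕ} (B : Finset (Fin n → ℤ)) (x : Fin n → ℤ) (θ : ℝ) :
    ‖charAvg B x θ‖ ≤ 1 := by
  unfold charAvg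
  rw [norm_div, Complex.norm_natCast]
  refine div_le_one_of_le₀ ((norm_sum_le _ _).trans ?_) (Nat.cast_nonneg _)
  refine (Finset.sum_le_card_nsmul _ _ 1 fun y _ => ?_).trans (by simp)
  have : 2 * (Real.pi : ℂ) * Complex.I * (θ : ℂ) * ((∑ j, x j * y j : ℤ) : ℂ) =
      ((2 * Real.pi * θ * (∑ j, x j * y j : ℤ) : ℝ) : ℂ) * Complex.I := by push_cast; ring
  rw [this, Complex.norm_exp_ofReal_mul_I]

lemma fourierAvg_le_one {n : ℕ} (B : Finset (Fin n → ℤ)) (x : Fin n → ℤ) : fourierAvg B x ≤ 1 := by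
  unfold fourierAvg
  calc ∫ θ in (0 : ℝ)..1, ‖charAvg B x θ‖ ≤ ∫ _θ in (0 : ℝ)..1, (1 : ℝ) :=
        intervalIntegral.integral_mono_on zero_le_one
          ((continuous_norm_charAvg B x).intervalIntegrable _ _) (by simp)
          fun θ _ => norm_charAvg_le_one B x θ
    _ = 1 := by simp

open Filter Topology in
lemma mean_fourierAvg_rpow_le {n : ℕ} (hn : 0 < n) (A : TwoCube n)
    {κ ν β δ : ℝ} (hκ : 0 < κ) (hκ1 : κ ≤ 1) (hν : 0 < ν) (hν1 : ν ≤ 1) (hδ : 0 < δ)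
    (hκδ : 1 + Real.sqrt κ ≤ (2 : ℝ) ^ (δ / 4 / 4)) {S B : Finset (Fin n → ℤ)}
    (hSA : S ⊆ A.points) (hB : B ⊆ signCube n)
    (hS : (2 : ℝ) ^ ((1 - β + δ) * n) ≤ #S) (hT : (2 : ℝ) ^ (β * n) ≤ #B)
    {ℓ : ℕ} (hℓ : 0 < ℓ) :
    ((∑ x ∈ S, fourierAvg B x) / #S) ^ ((1 + ν) ^ 2) ≤
      Real.exp (-(ν * κ ^ 2 / 32 * (δ / 2 * n) / 8)) +
        24 / Real.sqrt (ν * κ ^ 2 / 32 * (δ / 2 * n)) * (A.r ℓ / (δ / 2 * n) ^ (2 * ℓ)) +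
        2 * (2 : ℝ) ^ (-(δ / 4 * n / 4)) := by
  set D : ℤ := ∑ j, |A.diff j| with hDdef
  have hD : ∀ j, |A.diff j| ≤ D := fun j =>
    Finset.single_le_sum (f := fun j => |A.diff j|) (fun j _ => abs_nonneg _) (Finset.mem_univ j)
  have hcont : Continuous fun θ : ℝ => (∑ x ∈ S, ‖charAvg B x θ‖) / #S :=
    (continuous_finsetSum _ fun x _ => continuous_norm_charAvg B x).div_const _
  have hlim := tendsto_riemann_sum hcont
  have hint : ∫ θ in (0 : ℝ)..1, (∑ x ∈ S, ‖charAvg B x θ‖) / #S =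
      (∑ x ∈ S, fourierAvg B x) / #S := by
    rw [intervalIntegral.integral_div, intervalIntegral.integral_finsetSum fun x _ =>
      (continuous_norm_charAvg B x).intervalIntegrable _ _]
    rfl
  rw [hint] at hlim
  have hlim2 : Tendsto (fun N : ℕ => ((∑ k ∈ Finset.range N,
      (∑ x ∈ S, ‖charAvg B x (k / N)‖) / #S) / N) ^ ((1 + ν) ^ 2) - 2 / N) atTop
      (𝓝 (((∑ x ∈ S, fourierAvg B x) / #S) ^ ((1 + ν) ^ 2) - 0)) :=
    (hlim.rpow_const (Or.inr (by positivity))).sub (tendsto_const_div_atTop_nhds_zero_nat 2)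
  rw [sub_zero] at hlim2
  refine le_of_tendsto_of_frequently hlim2 ?_
  rw [Filter.frequently_atTop]
  intro N₀
  -- Beyond this bound, a signed sum of `2 ℓ` doubled differences vanishes modulo `N` only if it
  -- is `0`.
  obtain ⟨N, hN, hp⟩ := Nat.exists_infinite_primes (N₀ + (2 * (2 * ℓ : ℕ) * D).toNat + 1)
  have : NeZero N := ⟨hp.ne_zero⟩
  refine ⟨N, by omega, ?_⟩
  have hND : 2 * (2 * ℓ : ℕ) * D < (N : ℤ) := by
    have := Int.self_le_toNat (2 * (2 * ℓ : ℕ) * D)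
    have h2 : ((N₀ + (2 * (2 * ℓ : ℕ) * D).toNat + 1 : ℕ) : ℤ) ≤ N := by exact_mod_cast hN
    push_cast at h2 this ⊢
    have h3 : (0 : ℤ) ≤ N₀ := Int.natCast_nonneg _
    omega
  have := discrete_mean_rpow_le hp hn A hκ hκ1 hν hν1 hδ hκδ hSA hB hS hT hD hℓ hND
  linarith

/-! ### Conclusion -/

/-- For large `C`, in terms of `κ` and `δ` only, the three error terms are dominated by those in the
definition of `TwoCube.admissible`. -/
lemma error_terms_le {n : ℕ} (hn : 0 < n) {κ ν δ C r : ℝ} (hκ : 0 < κ) (hν : 0 < ν) (hν1 : ν ≤ 1)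
    (hδ : 0 < δ) (hr : 0 ≤ r) {ℓ : ℕ} (hℓ : 0 < ℓ)
    (hC1 : 512 / (κ ^ 2 * δ) ≤ C) (hC2 : 16 / (δ * Real.log 2) ≤ C)
    (hC3 : (1 + 50 * 24 * 8 / (κ * Real.sqrt δ)) * (4 / δ ^ 2) ≤ C) :
    Real.exp (-(ν * κ ^ 2 / 32 * (δ / 2 * n) / 8)) +
        24 / Real.sqrt (ν * κ ^ 2 / 32 * (δ / 2 * n)) * (r / (δ / 2 * n) ^ (2 * ℓ)) +
        2 * (2 : ℝ) ^ (-(δ / 4 * n / 4)) ≤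
      3 * Real.exp (-(ν * n / C)) +
        C ^ ℓ * r / (n : ℝ) ^ (2 * (ℓ : ℝ) + 1 / 2) / (50 * Real.sqrt ν) := by
  have hn0 : (0 : ℝ) < n := by exact_mod_cast hn
  have hlog : 0 < Real.log 2 := Real.log_pos (by norm_num)
  have hC : 0 < C := lt_of_lt_of_le (by positivity) hC1
  have e1 : Real.exp (-(ν * κ ^ 2 / 32 * (δ / 2 * n) / 8)) ≤ Real.exp (-(ν * n / C)) := by
    apply Real.exp_le_exp.2
    rw [neg_le_neg_iff, div_le_iff₀ hC]
    rw [div_le_iff₀ (by positivity)] at hC1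
    have : 0 < ν * n := by positivity
    nlinarith
  have e2 : (2 : ℝ) ^ (-(δ / 4 * n / 4)) ≤ Real.exp (-(ν * n / C)) := by
    rw [Real.rpow_def_of_pos (by norm_num)]
    apply Real.exp_le_exp.2
    rw [mul_neg, neg_le_neg_iff, div_le_iff₀ hC]
    rw [div_le_iff₀ (by positivity)] at hC2
    have : ν * n ≤ 1 * n := by gcongr
    nlinarith
  have hsq : Real.sqrt (ν * κ ^ 2 / 32 * (δ / 2 * n)) =
      Real.sqrt ν * κ * Real.sqrt δ * Real.sqrt n / 8 := by
    rw [show ν * κ ^ 2 / 32 * (δ / 2 * n) = ν * δ * n * (κ / 8) ^ 2 by ring,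
      Real.sqrt_mul (by positivity), Real.sqrt_sq (by positivity), Real.sqrt_mul (by positivity),
      Real.sqrt_mul (by positivity)]
    ring
  have hpow : (n : ℝ) ^ (2 * (ℓ : ℝ) + 1 / 2) = (n : ℝ) ^ (2 * ℓ) * Real.sqrt n := by
    rw [Real.rpow_add hn0, ← Real.sqrt_eq_rpow]
    congr 1
    rw [← Real.rpow_natCast]; push_cast; rfl
  have hCℓ : 50 * 24 * 8 / (κ * Real.sqrt δ) * (4 / δ ^ 2) ^ ℓ ≤ C ^ ℓ := by
    set K := 50 * 24 * 8 / (κ * Real.sqrt δ) with hK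
    have hK0 : 0 < K := by positivity
    calc K * (4 / δ ^ 2) ^ ℓ ≤ (1 + K) ^ ℓ * (4 / δ ^ 2) ^ ℓ := by
          gcongr
          calc K ≤ 1 + K := by linarith
            _ ≤ (1 + K) ^ ℓ := le_self_pow₀ (by linarith) hℓ.ne'
      _ = ((1 + K) * (4 / δ ^ 2)) ^ ℓ := (mul_pow _ _ _).symm
      _ ≤ C ^ ℓ := by gcongr
  have e3 : 24 / Real.sqrt (ν * κ ^ 2 / 32 * (δ / 2 * n)) * (r / (δ / 2 * n) ^ (2 * ℓ)) ≤
      C ^ ℓ * r / (n : ℝ) ^ (2 * (ℓ : ℝ) + 1 / 2) / (50 * Real.sqrt ν) := by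
    rw [hsq, hpow]
    have hs1 : 0 < Real.sqrt ν := Real.sqrt_pos.2 hν
    have hs2 : 0 < Real.sqrt δ := Real.sqrt_pos.2 hδ
    have hs3 : 0 < Real.sqrt n := Real.sqrt_pos.2 hn0
    have h1 : (δ / 2 * n) ^ (2 * ℓ) = (n : ℝ) ^ (2 * ℓ) / (4 / δ ^ 2) ^ ℓ := by
      rw [mul_pow, pow_mul, show (δ / 2) ^ 2 = (4 / δ ^ 2)⁻¹ by field_simp; norm_num, inv_pow]
      field_simp
    calc _ = 50 * 24 * 8 / (κ * Real.sqrt δ) * (4 / δ ^ 2) ^ ℓ *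
          (r / ((n : ℝ) ^ (2 * ℓ) * Real.sqrt n) / (50 * Real.sqrt ν)) := by
          rw [h1]; field_simp
      _ ≤ C ^ ℓ * (r / ((n : ℝ) ^ (2 * ℓ) * Real.sqrt n) / (50 * Real.sqrt ν)) := by gcongr
      _ = _ := by ring
  linarith

theorem theorem8 (β δ : ℝ) (hβ : 0 < β) (hδ : 0 < δ) :
    ∃ C : ℝ, 0 < C ∧
      ∀ (n : ℕ), 0 < n →
      ∀ (B : Finset (Fin n → ℤ)), B ⊆ signCube n → (#B : ℝ) = (2 : ℝ) ^ (β * (n : ℝ)) →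
      ∀ (A : TwoCube n),
        (#{x ∈ A.points | ¬ fourierAvg B x ≤ TwoCube.mu C A} : ℝ) ≤
          (2 : ℝ) ^ ((n : ℝ) * (1 - β + δ)) := by
  have hlog : 0 < Real.log 2 := Real.log_pos (by norm_num)
  have hgap : 0 < (2 : ℝ) ^ (δ / 4 / 4) - 1 := by
    have := Real.one_lt_rpow (x := 2) (by norm_num) (show 0 < δ / 4 / 4 by positivity)
    linarith
  obtain ⟨κ, hκ, hκ1, hκδ⟩ : ∃ κ : ℝ, 0 < κ ∧ κ ≤ 1 ∧
      1 + Real.sqrt κ ≤ (2 : ℝ) ^ (δ / 4 / 4) := by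
    refine ⟨min 1 (((2 : ℝ) ^ (δ / 4 / 4) - 1) ^ 2), by positivity, min_le_left _ _, ?_⟩
    have : Real.sqrt (min 1 (((2 : ℝ) ^ (δ / 4 / 4) - 1) ^ 2)) ≤ (2 : ℝ) ^ (δ / 4 / 4) - 1 :=
      Real.sqrt_le_iff.2 ⟨hgap.le, min_le_right _ _⟩
    linarith
  have c1 : 0 < 512 / (κ ^ 2 * δ) := by positivity
  have c2 : 0 < 16 / (δ * Real.log 2) := by positivity
  have c3 : 0 < (1 + 50 * 24 * 8 / (κ * Real.sqrt δ)) * (4 / δ ^ 2) := by positivity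
  set C := 512 / (κ ^ 2 * δ) + 16 / (δ * Real.log 2) +
    (1 + 50 * 24 * 8 / (κ * Real.sqrt δ)) * (4 / δ ^ 2) with hC
  refine ⟨C, by positivity, fun n hn B hB hcard A => ?_⟩
  by_contra hcon
  have hlt := not_le.1 hcon
  set S : Finset (Fin n → ℤ) := {x ∈ A.points | ¬ fourierAvg B x ≤ TwoCube.mu C A} with hSdef
  have hS0 : (0 : ℝ) < #S := lt_trans (by positivity) hlt
  have hSne : S.Nonempty := Finset.card_pos.1 (by exact_mod_cast hS0)
  have hSA : S ⊆ A.points := Finset.filter_subset _ _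
  have hSF : ∀ x ∈ S, A.mu C < fourierAvg B x := fun x hx => not_le.1 (Finset.mem_filter.1 hx).2
  obtain ⟨x₀, hx₀, hmin⟩ := S.exists_min_image (fourierAvg B) hSne
  have hx₀' := hSF x₀ hx₀
  unfold TwoCube.mu at hx₀'
  split_ifs at hx₀' with hadm
  swap
  -- With no admissible `μ` the bound is the trivial one, `1`.
  · exact absurd (fourierAvg_le_one B x₀) (not_le.2 hx₀')
  obtain ⟨μ, ⟨⟨hμ0, -⟩, ν, ⟨hν, hν1⟩, hμν⟩, hμlt⟩ := exists_lt_of_csInf_lt hadm hx₀'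
  set m := (∑ x ∈ S, fourierAvg B x) / #S with hm
  have hμm : μ < m := by
    rw [hm, lt_div_iff₀ hS0, mul_comm, ← nsmul_eq_mul, ← Finset.sum_const]
    exact Finset.sum_lt_sum_of_nonempty hSne fun x hx => hμlt.trans_le (hmin x hx)
  have hbound : ∀ ℓ : ℕ, 0 < ℓ → m ^ ((1 + ν) ^ 2) ≤
      3 * Real.exp (-(ν * n / C)) + A.RAt C ℓ / (50 * Real.sqrt ν) := by
    intro ℓ hℓ
    have h1 := mean_fourierAvg_rpow_le hn A hκ hκ1 hν hν1 hδ hκδ hSA hB (β := β)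
      (by rw [mul_comm]; exact hlt.le) hcard.ge hℓ
    have h2 := error_terms_le hn hκ hν hν1 hδ (Nat.cast_nonneg (A.r ℓ)) hℓ (C := C)
      (by linarith) (by linarith) (by linarith)
    refine (h1.trans h2).trans ?_
    unfold TwoCube.RAt
    gcongr
    exact le_add_of_nonneg_right (Real.exp_pos _).le
  have hs : 0 < 50 * Real.sqrt ν := by have := Real.sqrt_pos.2 hν; positivity
  have hR : (m ^ ((1 + ν) ^ 2) - 3 * Real.exp (-(ν * n / C))) * (50 * Real.sqrt ν) ≤ A.R C := by
    refine le_csInf ⟨_, 1, one_pos, rfl⟩ ?_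
    rintro _ ⟨ℓ, hℓ, rfl⟩
    rw [← le_div_iff₀ hs]
    linarith [hbound ℓ hℓ]
  rw [← le_div_iff₀ hs] at hR
  have hpow : μ ^ ((1 + ν) ^ 2) < m ^ ((1 + ν) ^ 2) :=
    Real.rpow_lt_rpow hμ0 hμm (by positivity)
  linarith
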